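/- Let $X\sim F$ be a real random variable with $0<E[X]<\infty$ and $P(X<0)>0$, and let $\alpha>0$ satisfy $E[e^{-\alpha X}]=1$. Put $\mathrm{es}_F=\sup\{y\mid F(y)<1\}$, $\mathrm{ei}_F=\inf\{y\mid F(y)>0\}$, $$d^{+}=\frac1\alpha\sup_{0<x<\mathrm{es}_F}-\log E[e^{-\alpha(X-x)}\mid X\ge x],\qquad d^{-}=\frac1\alpha\sup_{\mathrm{ei}_F<x<0}\log E[e^{\alpha(x-X)}\mid X<x],$$ and $d_0=d^{+}+d^{-}\in[0,\infty]$. Let $X_1,X_2,\dots$ be i.i.d. with distribution $F$, $S_0=0$, $S_n=\sum_{i=1}^n X_i$, and for $d>0$ let $$\tau_d^{RW}=\min\{n\mid \max_{0\le k\le n}S_k\ge S_n+d\},\qquad M_d^{RW}=\max_{0\le k\le\tau_d^{RW}}S_k .$$ For a Brownian motion with drift $B(t)=\mu t+\sigma W(t)$, where $W$ is a standard Brownian motion, $\mu>0$, $\sigma>0$ and $2\mu/\sigma^2=\alpha$, and for $D>0$, let similarly $\tau_D^{BM}=\min\{t\mid \max_{0\le s\le t}B(s)\ge B(t)+D\}$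 and $M_D^{BM}=\max_{0\le s\le\tau_D^{BM}}B(s)$. Then for every $d>0$ the time $\tau_d^{RW}$ is almost surely finite, $M_d^{RW}$ is a random variable, and $$E[M_d^{RW}]\le\frac{e^{\alpha(d+d_0)}-1}{\alpha}$$ (the right-hand side being $\infty$ if $d_0=\infty$). Moreover, if $d_0<\infty$, then for each such Brownian motion $M_{d+d_0}^{BM}$ is exponentially distributed with mean $(e^{\alpha(d+d_0)}-1)/\alpha$, and $M_d^{RW}$ is stochastically smaller than it: for all real $x$, $$P(M_d^{RW}>x)\le P(M_{d+d_0}^{BM}>x).$$ -/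

import Mathlib

open MeasureTheory ProbabilityTheory
open scoped NNReal ENNReal

namespace Drawdown

noncomputable section

/-- The set of times at which the path `f` is at least `d` below its running maximum. -/
def drawdownSet {T : Type*} [Preorder T] (f : T → ℝ) (d : ℝ) : Set T :=
  {t | f t + d ≤ sSup (f '' Set.Iic t)}

/-- The first time `τ_d` at which the path `f` achieves a drawdown of size `d`. It is used for
discrete time (`T = ℕ`) and for continuous time (`T = ℝ≥0`); it is meaningful when `drawdownSet f d`
is nonempty. -/
def drawdownTime {T : Type*} [ConditionallyCompleteLinearOrderBot T] (f : T → ℝ) (d : ℝ) : T :=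
  sInf (drawdownSet f d)

/-- The maximal height `M_d` of the path `f` up to the first time it achieves a drawdown `d`. -/
def maxBeforeDrawdown {T : Type*} [ConditionallyCompleteLinearOrderBot T] (f : T → ℝ) (d : ℝ) : ℝ :=
  sSup (f '' Set.Iic (drawdownTime f d))

/-- The random walk `S_0 = 0`, `S_n = X_0 + ⋯ + X_{n-1}`, as a path. -/
def walk {Ω : Type*} (X : ℕ → Ω → ℝ) (ω : Ω) (n : ℕ) : ℝ := ∑ i ∈ Finset.range n, X i ω

/-- The Brownian path `B(t) = μ t + σ W(t)` with drift `μ` and diffusion parameter `σ`. -/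
def driftedPath {Ω : Type*} (W : ℝ≥0 → Ω → ℝ) (μ σ : ℝ) (ω : Ω) (t : ℝ≥0) : ℝ :=
  μ * (t : ℝ) + σ * W t ω

/-- Essential supremum of the distribution `F`: `sup {y | F(y) < 1}`. -/
def essSupremum (F : Measure ℝ) : EReal := sSup ((fun y : ℝ => (y : EReal)) '' {y | cdf F y < 1})

/-- Essential infimum of the distribution `F`: `inf {y | F(y) > 0}`. -/
def essInfimum (F : Measure ℝ) : EReal := sInf ((fun y : ℝ => (y : EReal)) '' {y | 0 < cdf F y})

/-- `d⁺ = (1/α) sup_{0 < x < es_F} (- log E[exp(-α (X - x)) | X ≥ x])`, possibly `+∞`. -/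
def dPlus (F : Measure ℝ) (α : ℝ) : EReal :=
  ((1 / α : ℝ) : EReal) * ⨆ (x : ℝ) (_ : 0 < x ∧ (x : EReal) < essSupremum F),
    ((-Real.log (∫ y, Real.exp (-α * (y - x)) ∂(cond F (Set.Ici x))) : ℝ) : EReal)

/-- `d⁻ = (1/α) sup_{ei_F < x < 0} log E[exp(α (x - X)) | X < x]`, possibly `+∞`. -/
def dMinus (F : Measure ℝ) (α : ℝ) : EReal :=
  ((1 / α : ℝ) : EReal) * ⨆ (x : ℝ) (_ : essInfimum F < (x : EReal) ∧ x < 0),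
    ((Real.log (∫ y, Real.exp (α * (x - y)) ∂(cond F (Set.Iio x))) : ℝ) : EReal)

/-- `d_0 = d⁺ + d⁻`. -/
def dZero (F : Measure ℝ) (α : ℝ) : EReal := dPlus F α + dMinus F α

end

end Drawdown

/-! Fix a level `x ≥ 0`. Whether `M_d > x` is decided by a Markov chain `(r, y)`: `r` is the
distance from the running maximum up to `x`, `y` the current drawdown, and the chain stops when `r <
0` or `d ≤ y`. The theorem is an optional stopping argument for the function `exp(-lam r) (A - exp(α
y)) / (A - 1)`. With `A = exp(α d)` and `lam = α / (A - 1)` it is the exact exceedance probability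
for Brownian motion: it is built from the martingale `exp(-α S_n)`, and `lam` accounts for
reflection at `y = 0`.

A walk jumps over the maximum and over the drawdown barrier. The overshoot is controlled by `c =
exp(-α d⁺)`, the undershoot by `κ = exp(α d⁻)`. Taking `A = κ exp(α d)` and `lam` with `c (lam + α)
= A lam` turns the function into a supermartingale (`integral_value_chainStep_le`); the main point
is `exp_moment_overshoot_le`, which turns the bound `c`, valid at all levels, into a bound on
exponential moments. Solving gives `lam = α / (exp(α (d + d₀)) - 1)`, and starting from `(x, 0)`
gives `P(M_d > x) ≤ exp(-lam x)`. Integrating over `x` bounds the mean.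

The Brownian law comes from the same estimates. Sampled on a grid, the drifted motion is a Gaussian
walk with the same `α` for every mesh. Its overshoots vanish with the mesh, so the upper bound and a
matching submartingale bound (`le_integral_value_chainStep`) squeeze the exceedance probability
(`tendsto_measure_exceeds_gaussian`). Continuity of paths carries the limit over to the Brownian
maximum (`measure_lt_maxBeforeDrawdown_brownian`). -/

namespace Drawdown

/-! ### Exceedance of a level before a drawdown, in general time -/

/-- The path `f` exceeds the level `x` no later than its first drawdown of size `d`. -/
def Exceeds {T : Type*} [Preorder T] (f : T → ℝ) (d x : ℝ) : Prop :=
  ∃ t, x < f t ∧ ∀ s ∈ drawdownSet f d, t ≤ s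

/-- This form avoids both the supremum and the random time. Nonemptiness is essential: the infimum
of the empty set is `⊥`, which would cut the path at time `0`. -/
lemma lt_maxBeforeDrawdown_iff {T : Type*} [ConditionallyCompleteLinearOrderBot T] {f : T → ℝ}
    {d x : ℝ} (hf : ∀ t, BddAbove (f '' Set.Iic t)) (hne : (drawdownSet f d).Nonempty) :
    x < maxBeforeDrawdown f d ↔ Exceeds f d x := by
  unfold maxBeforeDrawdown Exceeds
  rw [lt_csSup_iff (hf _) (Set.Nonempty.image _ ⟨_, Set.mem_Iic.2 le_rfl⟩)]
  constructor
  · rintro ⟨_, ⟨t, ht, rfl⟩, hx⟩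
    exact ⟨t, hx, fun s hs => (Set.mem_Iic.1 ht).trans (csInf_le' hs)⟩
  · rintro ⟨t, hx, ht⟩
    exact ⟨_, ⟨t, Set.mem_Iic.2 (le_csInf hne ht), rfl⟩, hx⟩

lemma le_maxBeforeDrawdown_bot {T : Type*} [ConditionallyCompleteLinearOrderBot T] {f : T → ℝ}
    {d : ℝ} (hf : ∀ t, BddAbove (f '' Set.Iic t)) : f ⊥ ≤ maxBeforeDrawdown f d :=
  le_csSup (hf _) ⟨⊥, Set.mem_Iic.2 bot_le, rfl⟩

lemma bddAbove_image_Iic_nat (f : ℕ → ℝ) (n : ℕ) : BddAbove (f '' Set.Iic n) :=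
  ((Set.finite_Iic n).image f).bddAbove

lemma mem_drawdownSet_nat {f : ℕ → ℝ} {d : ℝ} {n : ℕ} :
    n ∈ drawdownSet f d ↔ ∃ i ≤ n, f n + d ≤ f i := by
  constructor
  · intro h
    obtain ⟨i, hi, h'⟩ := (Set.Nonempty.image f ⟨n, Set.mem_Iic.2 le_rfl⟩).csSup_mem
      ((Set.finite_Iic n).image f)
    exact ⟨i, hi, h' ▸ h⟩
  · rintro ⟨i, hi, h⟩
    exact h.trans (le_csSup (bddAbove_image_Iic_nat f n) ⟨i, hi, rfl⟩)

/-! ### The stopped chain of distance and drawdown -/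

/-- One step of the chain recording the distance `s.1` from the running maximum to a level and the
current drawdown `s.2`; it is frozen once the level is exceeded or the drawdown reaches `d`. -/
noncomputable def chainStep (d : ℝ) (s : ℝ × ℝ) (z : ℝ) : ℝ × ℝ :=
  if 0 ≤ s.1 ∧ s.2 < d then (s.1 - max (z - s.2) 0, max (s.2 - z) 0) else s

/-- The chain with steps `chainStep`, driven by the increments `z`, for the level `x`. -/
noncomputable def chain (d x : ℝ) (z : ℕ → ℝ) : ℕ → ℝ × ℝ
  | 0 => (x, 0)
  | n + 1 => chainStep d (chain d x z n) (z n)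

/-- The partial sums of `z`. -/
noncomputable def partialSum (z : ℕ → ℝ) (n : ℕ) : ℝ := ∑ i ∈ Finset.range n, z i

lemma chain_snd_nonneg (d x : ℝ) (z : ℕ → ℝ) (n : ℕ) : 0 ≤ (chain d x z n).2 := by
  induction n with
  | zero => simp [chain]
  | succ n ih =>
    simp only [chain, chainStep]
    split_ifs
    · exact le_max_right _ _
    · exact ih

lemma chain_eq_of_le {d x : ℝ} {z : ℕ → ℝ} {n : ℕ}
    (h : ¬ (0 ≤ (chain d x z n).1 ∧ (chain d x z n).2 < d)) {N : ℕ} (hN : n ≤ N) :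
    chain d x z N = chain d x z n := by
  induction N, hN using Nat.le_induction with
  | base => rfl
  | succ N _ ih => rw [chain, chainStep, ih, if_neg h]

/-- The path is neither above `x` nor at drawdown `d` at any time up to `j`. -/
def Alive (f : ℕ → ℝ) (d x : ℝ) (j : ℕ) : Prop :=
  partialSups f j ≤ x ∧ partialSups f j - f j < d

lemma chain_eq_of_alive {d x : ℝ} (z : ℕ → ℝ) {n : ℕ}
    (h : ∀ j < n, Alive (partialSum z) d x j) :
    chain d x z n =
      (x - partialSups (partialSum z) n, partialSups (partialSum z) n - partialSum z n) := by
  induction n with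
  | zero => simp [chain, partialSum]
  | succ n ih =>
    have h1 := ih fun j hj => h j (hj.trans n.lt_succ_self)
    obtain ⟨h2, h3⟩ := h n n.lt_succ_self
    have hs : partialSum z (n + 1) = partialSum z n + z n := Finset.sum_range_succ _ _
    have hm : partialSups (partialSum z) (n + 1) =
        max (partialSups (partialSum z) n) (partialSum z (n + 1)) := partialSups_add_one _ _
    rw [chain, h1, chainStep, if_pos ⟨by simpa using h2, by simpa using h3⟩, hm, hs]
    refine Prod.ext ?_ ?_ <;> simp only
    · rcases le_total (partialSups (partialSum z) n) (partialSum z n + z n) with h | h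
      · rw [max_eq_left (by linarith), max_eq_right h]; ring
      · rw [max_eq_right (by linarith), max_eq_left h]; ring
    · rcases le_total (partialSups (partialSum z) n) (partialSum z n + z n) with h | h
      · rw [max_eq_right (by linarith), max_eq_right h]; ring
      · rw [max_eq_left (by linarith), max_eq_left h]; ring

lemma not_alive_of_mem {f : ℕ → ℝ} {d x : ℝ} {n : ℕ} (h : n ∈ drawdownSet f d) :
    ¬ Alive f d x n := by
  obtain ⟨i, hi, h⟩ := mem_drawdownSet_nat.1 h
  rintro ⟨-, h2⟩
  linarith [le_partialSups_of_le f hi]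

/-- Up to the first time that is not `Alive` the chain records the path exactly, and afterwards it
is frozen, so the sign of its first coordinate at that time decides the event. -/
lemma exists_chain_fst_neg_iff {d x : ℝ} (z : ℕ → ℝ) :
    (∃ n, (chain d x z n).1 < 0) ↔ Exceeds (partialSum z) d x := by
  classical
  set f := partialSum z
  constructor
  · rintro ⟨N, hN⟩
    by_cases hex : ∃ n, ¬ Alive f d x n
    · have hn := Nat.find_spec hex
      have hlt : ∀ j < Nat.find hex, Alive f d x j := fun j hj => not_not.1 (Nat.find_min hex hj)
      set n := Nat.find hex
      have hc := chain_eq_of_alive z hlt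
      have hneg : (chain d x z n).1 < 0 := by
        rcases le_or_gt n N with h | h
        · rwa [← chain_eq_of_le _ h]
          rw [hc]
          intro hh
          exact hn ⟨by simpa using hh.1, hh.2⟩
        · rw [chain_eq_of_alive z fun j hj => hlt j (hj.trans h)] at hN
          have := (hlt N h).1
          simp only at hN
          linarith
      rw [hc] at hneg
      simp only at hneg
      have hx : x < partialSups f n := by linarith
      refine ⟨n, ?_, fun s hs => ?_⟩
      · obtain ⟨k, hk, hk'⟩ := exists_partialSups_eq f n
        rcases hk.lt_or_eq with h | rfl
        · have := (hlt k h).1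
          have := le_partialSups f k
          linarith
        · linarith
      · by_contra! h
        exact not_alive_of_mem hs (hlt s h)
    · push Not at hex
      rw [chain_eq_of_alive z fun j _ => hex j] at hN
      have := (hex N).1
      simp only at hN
      linarith
  · rintro ⟨t, ht, hs⟩
    have hex : ∃ t, x < f t := ⟨t, ht⟩
    refine ⟨Nat.find hex, ?_⟩
    rw [chain_eq_of_alive z]
    · have := Nat.find_spec hex
      have := le_partialSups f (Nat.find hex)
      simp only
      linarith
    · intro j hj
      refine ⟨partialSups_le _ _ _ fun i hi =>
        not_lt.1 (Nat.find_min hex (hi.trans_lt hj)), ?_⟩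
      by_contra! h
      obtain ⟨i, hi, hi'⟩ := exists_partialSups_eq f j
      -- A drawdown at `j` cannot precede the exceedance time `t`, while `j` lies before the first
      -- exceedance.
      have : t ≤ j := hs j (mem_drawdownSet_nat.2 ⟨i, hi, by linarith⟩)
      exact absurd (hj.trans_le (Nat.find_min' hex ht)) (not_lt.2 this)

lemma chain_eventually_stopped {d x : ℝ} (z : ℕ → ℝ)
    (h : (drawdownSet (partialSum z) d).Nonempty) :
    ∃ n, ∀ N ≥ n, ¬ (0 ≤ (chain d x z N).1 ∧ (chain d x z N).2 < d) := by
  classical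
  obtain ⟨s, hs⟩ := h
  have hex : ∃ n, ¬ Alive (partialSum z) d x n := ⟨s, not_alive_of_mem hs⟩
  have hn := Nat.find_spec hex
  have hc := chain_eq_of_alive z (n := Nat.find hex)
    fun j hj => not_not.1 (Nat.find_min hex hj)
  have hc' : ¬ (0 ≤ (chain d x z (Nat.find hex)).1 ∧ (chain d x z (Nat.find hex)).2 < d) := by
    rw [hc]
    intro hh
    exact hn ⟨by simpa using hh.1, hh.2⟩
  exact ⟨_, fun N hN => by rwa [chain_eq_of_le hc' hN]⟩


/-! ### Exponential moments of the overshoot -/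

lemma integral_exp_overshoot_kernel {α c A lam : ℝ}
    (hA : c * (lam + α) = A * lam) {h L : ℝ} (hh : 0 ≤ h) (hL : 0 ≤ L) :
    ∫ u in Set.Ioc 0 L, (Set.Iio h).indicator
      (fun u => (lam + α) * Real.exp (lam * u) * (Real.exp (-α * (h - u)) - c)) u =
    Real.exp (-α * h) * (Real.exp ((lam + α) * min h L) - 1) -
      A * (Real.exp (lam * min h L) - 1) := by
  rw [setIntegral_indicator measurableSet_Iio]
  have hset : (Set.Ioc 0 L ∩ Set.Iio h : Set ℝ) =ᵐ[volume] Set.Ioc 0 (min h L) := by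
    have : (Set.Iio h : Set ℝ) =ᵐ[volume] Set.Iic h := Iio_ae_eq_Iic
    have h2 := (ae_eq_refl (Set.Ioc 0 L)).inter this
    refine h2.trans (Filter.EventuallyEq.of_eq (Set.ext fun u => ?_))
    simp only [Set.mem_inter_iff, Set.mem_Ioc, Set.mem_Iic, le_min_iff]
    tauto
  rw [setIntegral_congr_set hset, ← intervalIntegral.integral_of_le (le_min hh hL)]
  -- The relation `hA` makes the `c` term of the integrand the derivative of `A * exp (lam * u)`.
  have hd : ∀ u ∈ Set.uIcc 0 (min h L), HasDerivAt
      (fun u => Real.exp (-α * h) * Real.exp ((lam + α) * u) - A * Real.exp (lam * u))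
      ((lam + α) * Real.exp (lam * u) * (Real.exp (-α * (h - u)) - c)) u := by
    intro u _
    have h1 := (((hasDerivAt_id u).const_mul (lam + α)).exp).const_mul (Real.exp (-α * h))
    have h2 := (((hasDerivAt_id u).const_mul lam).exp).const_mul A
    refine (h1.sub h2).congr_deriv ?_
    have e1 : Real.exp ((lam + α) * u) = Real.exp (lam * u) * Real.exp (α * u) := by
      rw [← Real.exp_add]; ring_nf
    have e2 : Real.exp (-α * (h - u)) = Real.exp (-α * h) * Real.exp (α * u) := by
      rw [← Real.exp_add]; ring_nf
    simp only [id, mul_one]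
    rw [e1, e2]
    linear_combination Real.exp (lam * u) * hA
  rw [intervalIntegral.integral_eq_sub_of_hasDerivAt hd
    (by apply Continuous.intervalIntegrable; fun_prop)]
  simp
  ring

/-- A lower bound `c` for the conditional expectation of `exp (-α * overshoot)` over every level
controls the exponential moments of the overshoot. -/
lemma exp_moment_overshoot_le {F : Measure ℝ} [IsFiniteMeasure F] {α c A lam : ℝ} (hα : 0 < α)
    (hlam : 0 < lam) (hA : c * (lam + α) = A * lam)
    (Hup : ∀ x, 0 ≤ x → 0 ≤ ∫ z in Set.Ioi x, (Real.exp (-α * (z - x)) - c) ∂F)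
    {y L : ℝ} (hy : 0 ≤ y) (hL : 0 ≤ L) :
    ∫ z in Set.Ioi y, ((A - 1) * (Real.exp (lam * min (z - y) L) - 1)
      - (1 - Real.exp (-α * (z - y)))) ∂F ≤ 0 := by
  have hbd : ∀ z ∈ Set.Ioi y, Real.exp (-α * (z - y)) ≤ 1 := fun z hz => by
    rw [Real.exp_le_one_iff]
    have : y < z := hz
    nlinarith
  have hint1 : IntegrableOn (fun z => Real.exp (-α * (z - y))) (Set.Ioi y) F := by
    refine Integrable.of_bound (by fun_prop) 1 ?_
    filter_upwards [ae_restrict_mem measurableSet_Ioi] with z hz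
    rw [Real.norm_eq_abs, abs_of_pos (Real.exp_pos _)]
    exact hbd z hz
  have hint2 : IntegrableOn (fun z => Real.exp (lam * min (z - y) L)) (Set.Ioi y) F := by
    refine Integrable.of_bound (by fun_prop) (Real.exp (lam * L)) ?_
    filter_upwards with z
    rw [Real.norm_eq_abs, abs_of_pos (Real.exp_pos _)]
    gcongr
    exact min_le_right _ _
  -- The hypothesis at level `y + u` is averaged over `0 < u ≤ L` with weight `(lam + α) * exp (lam
  -- * u)`; Fubini then makes the integrand a function of the overshoot `z - y` alone.
  set g : ℝ → ℝ → ℝ := fun z u => (Set.Iio (z - y)).indicator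
      (fun u => (lam + α) * Real.exp (lam * u) * (Real.exp (-α * ((z - y) - u)) - c)) u with hg
  have hgm : Measurable (Function.uncurry g) := by
    have : Function.uncurry g = {p : ℝ × ℝ | p.2 < p.1 - y}.indicator (fun p =>
      (lam + α) * Real.exp (lam * p.2) * (Real.exp (-α * ((p.1 - y) - p.2)) - c)) := by
      ext ⟨z, u⟩
      simp [g, Set.indicator]
    rw [this]
    exact Measurable.indicator (by fun_prop) (measurableSet_lt (by fun_prop) (by fun_prop))
  have hgi : Integrable (Function.uncurry g)
      ((F.restrict (Set.Ioi y)).prod (volume.restrict (Set.Ioc 0 L))) := by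
    refine Integrable.of_bound hgm.aestronglyMeasurable
      ((lam + α) * Real.exp (lam * L) * (1 + |c|)) ?_
    rw [Measure.prod_restrict]
    filter_upwards [ae_restrict_mem (measurableSet_Ioi.prod measurableSet_Ioc)] with p hp
    obtain ⟨z, u⟩ := p
    obtain ⟨-, hu⟩ := hp
    simp only [Set.mem_Ioc] at hu
    simp only [Function.uncurry, g, Set.indicator]
    split_ifs with h
    · have h1 : Real.exp (-α * ((z - y) - u)) ≤ 1 := by
        rw [Real.exp_le_one_iff]
        have : u < z - y := h
        nlinarith
      rw [norm_mul, norm_mul, Real.norm_eq_abs, Real.norm_eq_abs, Real.norm_eq_abs,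
        abs_of_pos (by positivity : 0 < lam + α), abs_of_pos (Real.exp_pos _)]
      gcongr
      · exact hu.2
      · refine (abs_sub _ _).trans ?_
        rw [abs_of_pos (Real.exp_pos _)]
        gcongr
    · rw [norm_zero]
      positivity
  have hswap := integral_integral_swap hgi
  have hpos : 0 ≤ ∫ z in Set.Ioi y, ∫ u in Set.Ioc 0 L, g z u ∂volume ∂F := by
    rw [hswap]
    refine setIntegral_nonneg measurableSet_Ioc fun u hu => ?_
    have h1 : ∫ z in Set.Ioi y, g z u ∂F = ((lam + α) * Real.exp (lam * u)) *
        ∫ z in Set.Ioi (y + u), (Real.exp (-α * (z - (y + u))) - c) ∂F := by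
      rw [← integral_const_mul]
      have : (fun z => g z u) = (Set.Ioi (y + u)).indicator (fun z =>
          (lam + α) * Real.exp (lam * u) * (Real.exp (-α * (z - (y + u))) - c)) := by
        ext z
        simp only [g, Set.indicator, Set.mem_Iio, Set.mem_Ioi]
        have : (u < z - y) = (y + u < z) := by
          apply propext; constructor <;> intro h <;> linarith
        simp only [this, sub_sub]
      rw [this, setIntegral_indicator measurableSet_Ioi, Set.Ioi_inter_Ioi,
        sup_of_le_right (by linarith [hu.1])]
    rw [h1]
    exact mul_nonneg (by positivity) (Hup _ (by linarith [hu.1]))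
  refine le_of_neg_le_neg ?_
  rw [neg_zero, ← integral_neg]
  refine hpos.trans (setIntegral_mono_on hgi.integral_prod_left ?_ measurableSet_Ioi ?_)
  · exact (((hint2.sub (integrable_const _)).const_mul _).sub
      ((integrable_const _).sub hint1)).neg
  · intro z hz
    have hz' : 0 ≤ z - y := by have : y < z := hz; linarith
    simp only [hg]
    rw [integral_exp_overshoot_kernel hA hz' hL]
    -- The only loss: equality holds when `z - y ≤ L`.
    have e1 : Real.exp (-α * (z - y)) * Real.exp ((lam + α) * min (z - y) L) ≤
        Real.exp (lam * min (z - y) L) := by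
      rw [← Real.exp_add, Real.exp_le_exp]
      have := min_le_left (z - y) L
      nlinarith
    linarith

/-! ### One-step inequalities for the value function -/

/-- The value function of the chain: `K` above the level, `0` after the drawdown. -/
noncomputable def value (α lam A K d : ℝ) (s : ℝ × ℝ) : ℝ :=
  if s.1 < 0 then K else if d ≤ s.2 then 0
  else Real.exp (-lam * s.1) * ((A - Real.exp (α * s.2)) / (A - 1))

/-- Multiplying by `(A - 1) * exp (lam * r)` clears denominators and leaves `r` only in the branch
where the step sets a new maximum. -/
lemma value_chainStep {α lam A K d r y : ℝ} (hA : 1 < A) (hr : 0 ≤ r) (hy : y < d)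
    (hd : 0 < d) (z : ℝ) :
    (A - 1) * Real.exp (lam * r) * value α lam A K d (chainStep d (r, y) z) =
    (if y < z then (A - 1) * (if r < z - y then Real.exp (lam * r) * K
        else Real.exp (lam * (z - y)))
      else if z ≤ y - d then 0 else A - Real.exp (α * (y - z))) := by
  have hA' : A - 1 ≠ 0 := by linarith
  rw [chainStep, if_pos ⟨hr, hy⟩]
  rcases lt_or_ge y z with h | h
  · rw [if_pos h, max_eq_left (by linarith), max_eq_right (by linarith)]
    unfold value
    simp only
    by_cases h2 : r < z - y
    · rw [if_pos h2, if_pos (by linarith)]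
      ring
    · rw [if_neg h2, if_neg (by linarith), if_neg (by linarith), mul_zero, Real.exp_zero,
        div_self hA', mul_one, mul_assoc, ← Real.exp_add]
      ring_nf
  · rw [if_neg (not_lt.2 h), max_eq_right (by linarith), max_eq_left (by linarith)]
    unfold value
    simp only [sub_zero]
    rw [if_neg (not_lt.2 hr)]
    by_cases h2 : z ≤ y - d
    · rw [if_pos h2, if_pos (by linarith), mul_zero]
    · rw [if_neg h2, if_neg (by linarith), neg_mul, Real.exp_neg]
      have := Real.exp_ne_zero (lam * r)
      field_simp

lemma value_of_stopped {α lam A K d : ℝ} {s : ℝ × ℝ} (h : ¬ (0 ≤ s.1 ∧ s.2 < d)) :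
    value α lam A K d s = if s.1 < 0 then K else 0 := by
  unfold value
  by_cases h1 : s.1 < 0
  · simp [h1]
  · rw [if_neg h1, if_neg h1, if_pos]
    by_contra! h2
    exact h ⟨not_lt.1 h1, h2⟩

lemma value_of_alive {α lam A K d : ℝ} {s : ℝ × ℝ} (h : 0 ≤ s.1 ∧ s.2 < d) :
    value α lam A K d s = Real.exp (-lam * s.1) * ((A - Real.exp (α * s.2)) / (A - 1)) := by
  unfold value
  rw [if_neg (not_lt.2 h.1), if_neg (not_le.2 h.2)]

lemma measurable_value (α lam A K d : ℝ) : Measurable (value α lam A K d) := by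
  unfold value
  refine Measurable.ite (measurableSet_lt measurable_fst measurable_const) measurable_const ?_
  exact Measurable.ite (measurableSet_le measurable_const measurable_snd) measurable_const
    (by fun_prop)

lemma measurable_chainStep (d : ℝ) :
    Measurable (fun p : (ℝ × ℝ) × ℝ => chainStep d p.1 p.2) := by
  unfold chainStep
  refine Measurable.ite ?_ (by fun_prop) (by fun_prop)
  exact (measurableSet_le measurable_const (by fun_prop : Measurable fun p : (ℝ × ℝ) × ℝ =>
    p.1.1)).inter (measurableSet_lt (by fun_prop : Measurable fun p : (ℝ × ℝ) × ℝ => p.1.2)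
    measurable_const)

lemma value_nonneg {α lam A K d : ℝ} (hα : 0 < α) (hA : 1 < A) (hd : Real.exp (α * d) ≤ A)
    (hK : 0 ≤ K) (s : ℝ × ℝ) : 0 ≤ value α lam A K d s := by
  unfold value
  split_ifs with h1 h2
  · exact hK
  · exact le_rfl
  · refine mul_nonneg (Real.exp_pos _).le (div_nonneg ?_ (by linarith))
    have : Real.exp (α * s.2) ≤ Real.exp (α * d) := by
      gcongr
      exact (not_le.1 h2).le
    linarith

lemma value_le {α lam A K d : ℝ} (hα : 0 < α) (hlam : 0 < lam) (hA : 1 < A)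
    (hK : 1 ≤ K) {s : ℝ × ℝ} (hs : 0 ≤ s.2) : value α lam A K d s ≤ K := by
  unfold value
  split_ifs with h1 h2
  · exact le_rfl
  · linarith
  · refine le_trans ?_ hK
    have h3 : (A - Real.exp (α * s.2)) / (A - 1) ≤ 1 := by
      rw [div_le_one (by linarith)]
      have : 1 ≤ Real.exp (α * s.2) := Real.one_le_exp (by positivity)
      linarith
    refine (mul_le_of_le_one_right (Real.exp_pos _).le h3).trans ?_
    rw [Real.exp_le_one_iff]
    nlinarith

/-- Supermartingale property, with value `1` above the level. The value after a step is the function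
`A - exp (α (y - z))`, whose mean is exact by `hα_eq`, plus one correction for a new maximum and one
for a completed drawdown; each correction has nonpositive integral. -/
lemma integral_value_chainStep_le {F : Measure ℝ} [IsProbabilityMeasure F]
    {α c κ A lam d : ℝ} (hα : 0 < α)
    (hlam : 0 < lam) (hA : c * (lam + α) = A * lam) (hd : 0 < d) (hκ : A = κ * Real.exp (α * d))
    (hA1 : 1 < A)
    (hα_int : Integrable (fun y : ℝ => Real.exp (-α * y)) F)
    (hα_eq : ∫ y, Real.exp (-α * y) ∂F = 1)
    (Hup : ∀ x, 0 ≤ x → 0 ≤ ∫ z in Set.Ioi x, (Real.exp (-α * (z - x)) - c) ∂F)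
    (Hdown : ∀ x < 0, ∫ z in Set.Iic x, (Real.exp (α * (x - z)) - κ) ∂F ≤ 0)
    {s : ℝ × ℝ} (hs : 0 ≤ s.2) :
    ∫ z, value α lam A 1 d (chainStep d s z) ∂F ≤ value α lam A 1 d s := by
  by_cases hal : 0 ≤ s.1 ∧ s.2 < d
  swap
  · simp [chainStep, if_neg hal]
  obtain ⟨r, y⟩ := s
  obtain ⟨hr, hy⟩ := hal
  simp only at hr hy hs
  have hA' : 0 < A - 1 := by linarith
  have hint : Integrable (fun z => Real.exp (α * (y - z))) F := by
    have : (fun z => Real.exp (α * (y - z))) = fun z => Real.exp (α * y) * Real.exp (-α * z) := by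
      ext z; rw [← Real.exp_add]; ring_nf
    rw [this]
    exact hα_int.const_mul _
  have hval : ∫ z, Real.exp (α * (y - z)) ∂F = Real.exp (α * y) := by
    have : (fun z => Real.exp (α * (y - z))) = fun z => Real.exp (α * y) * Real.exp (-α * z) := by
      ext z; rw [← Real.exp_add]; ring_nf
    rw [this, integral_const_mul, hα_eq, mul_one]
  have key : ∀ z, (A - 1) * Real.exp (lam * r) * value α lam A 1 d (chainStep d (r, y) z) =
      (Set.Ioi y).indicator (fun z => (A - 1) * (Real.exp (lam * min (z - y) r) - 1)
        - (1 - Real.exp (-α * (z - y)))) z +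
      (Set.Iic (y - d)).indicator (fun z => Real.exp (α * (y - z)) - A) z +
      (A - Real.exp (α * (y - z))) := by
    intro z
    rw [value_chainStep hA1 hr hy hd]
    simp only [Set.indicator, Set.mem_Ioi, Set.mem_Iic]
    by_cases h1 : y < z
    · have h3 : ¬ z ≤ y - d := by linarith
      have e : -α * (z - y) = α * (y - z) := by ring
      rw [if_pos h1, if_pos h1, if_neg h3, e]
      by_cases h2 : r < z - y
      · rw [if_pos h2, min_eq_right h2.le]; ring
      · rw [if_neg h2, min_eq_left (not_lt.1 h2)]; ring
    · rw [if_neg h1, if_neg h1]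
      split_ifs <;> ring
  have hi1 : IntegrableOn (fun z => (A - 1) * (Real.exp (lam * min (z - y) r) - 1)
        - (1 - Real.exp (-α * (z - y)))) (Set.Ioi y) F := by
    refine ((Integrable.sub ?_ (integrable_const _)).const_mul _).sub
      ((integrable_const _).sub ?_)
    · refine Integrable.of_bound (by fun_prop) (Real.exp (lam * r)) ?_
      filter_upwards with z
      rw [Real.norm_eq_abs, abs_of_pos (Real.exp_pos _)]
      gcongr
      exact min_le_right _ _
    · refine (hint.congr ?_).integrableOn
      filter_upwards with z
      ring_nf
  have hi2 : IntegrableOn (fun z => Real.exp (α * (y - z)) - A) (Set.Iic (y - d)) F :=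
    (hint.sub (integrable_const _)).integrableOn
  have hsum : (A - 1) * Real.exp (lam * r) * ∫ z, value α lam A 1 d (chainStep d (r, y) z) ∂F ≤
      A - Real.exp (α * y) := by
    rw [← integral_const_mul]
    simp_rw [key]
    rw [integral_add, integral_add, integral_indicator measurableSet_Ioi,
      integral_indicator measurableSet_Iic, integral_sub (integrable_const _) hint, hval]
    · have h1 := exp_moment_overshoot_le hα hlam hA Hup hs hr
      -- The drawdown barrier is hit by a jump below `y - d < 0`, and `A = κ * exp (α * d)` makes
      -- this the hypothesis `Hdown` at that level.
      have h2 : ∫ z in Set.Iic (y - d), (Real.exp (α * (y - z)) - A) ∂F ≤ 0 := by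
        have : (fun z => Real.exp (α * (y - z)) - A) = fun z =>
            Real.exp (α * d) * (Real.exp (α * ((y - d) - z)) - κ) := by
          ext z
          have : Real.exp (α * (y - z)) = Real.exp (α * d) * Real.exp (α * ((y - d) - z)) := by
            rw [← Real.exp_add]; ring_nf
          rw [this, hκ]
          ring
        rw [this, integral_const_mul]
        exact mul_nonpos_of_nonneg_of_nonpos (Real.exp_pos _).le (Hdown _ (by linarith))
      simp only [integral_const, probReal_univ, one_smul]
      linarith
    · exact hi1.integrable_indicator measurableSet_Ioi
    · exact hi2.integrable_indicator measurableSet_Iic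
    · exact (hi1.integrable_indicator measurableSet_Ioi).add
        (hi2.integrable_indicator measurableSet_Iic)
    · exact (integrable_const _).sub hint
  rw [value_of_alive ⟨hr, hy⟩]
  simp only
  rw [neg_mul, Real.exp_neg, inv_mul_eq_div, div_div, le_div_iff₀ (by positivity)]
  linarith

/-- Submartingale property with the Brownian parameters. Jumping past the drawdown barrier only
helps, since there the untruncated function is nonpositive; jumping past the level is compensated by
a terminal reward `K` that dominates the mean of `exp (lam * overshoot)`. -/
lemma le_integral_value_chainStep {F : Measure ℝ} [IsProbabilityMeasure F]
    {α A lam d K : ℝ} (hα : 0 < α)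
    (hlam : lam * (A - 1) = α) (hd : 0 < d) (hA : A = Real.exp (α * d))
    (hα_int : Integrable (fun y : ℝ => Real.exp (-α * y)) F)
    (hα_eq : ∫ y, Real.exp (-α * y) ∂F = 1)
    (hlam_int : Integrable (fun y : ℝ => Real.exp (lam * y)) F)
    (hK1 : 1 ≤ K)
    (hK : ∀ x, 0 ≤ x → 0 ≤ ∫ z in Set.Ioi x, (K - Real.exp (lam * (z - x))) ∂F)
    {s : ℝ × ℝ} (hs : 0 ≤ s.2) :
    value α lam A K d s ≤ ∫ z, value α lam A K d (chainStep d s z) ∂F := by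
  have hA1 : 1 < A := by
    rw [hA]; exact Real.one_lt_exp_iff.2 (by positivity)
  by_cases hal : 0 ≤ s.1 ∧ s.2 < d
  swap
  · simp [chainStep, if_neg hal]
  obtain ⟨r, y⟩ := s
  obtain ⟨hr, hy⟩ := hal
  simp only at hr hy hs
  have hA' : 0 < A - 1 := by linarith
  have hlam0 : 0 < lam := by
    by_contra! h
    nlinarith
  have hint : Integrable (fun z => Real.exp (α * (y - z))) F := by
    have : (fun z => Real.exp (α * (y - z))) = fun z => Real.exp (α * y) * Real.exp (-α * z) := by
      ext z; rw [← Real.exp_add]; ring_nf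
    rw [this]
    exact hα_int.const_mul _
  have hval : ∫ z, Real.exp (α * (y - z)) ∂F = Real.exp (α * y) := by
    have : (fun z => Real.exp (α * (y - z))) = fun z => Real.exp (α * y) * Real.exp (-α * z) := by
      ext z; rw [← Real.exp_add]; ring_nf
    rw [this, integral_const_mul, hα_eq, mul_one]
  have hint2 : Integrable (fun z => Real.exp (lam * (z - (y + r)))) F := by
    have : (fun z => Real.exp (lam * (z - (y + r)))) =
        fun z => Real.exp (-lam * (y + r)) * Real.exp (lam * z) := by
      ext z; rw [← Real.exp_add]; ring_nf
    rw [this]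
    exact hlam_int.const_mul _
  have key : ∀ z, (Set.Ioi (y + r)).indicator
        (fun z => (A - 1) * Real.exp (lam * r) * (K - Real.exp (lam * (z - (y + r))))) z +
      (A - Real.exp (α * (y - z))) ≤
      (A - 1) * Real.exp (lam * r) * value α lam A K d (chainStep d (r, y) z) := by
    intro z
    rw [value_chainStep hA1 hr hy hd]
    simp only [Set.indicator, Set.mem_Ioi]
    by_cases h1 : y < z
    · have h3 : A - Real.exp (α * (y - z)) ≤ (A - 1) * Real.exp (lam * (z - y)) := by
        have h4 := Real.add_one_le_exp (lam * (z - y))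
        have h5 := Real.add_one_le_exp (α * (y - z))
        have : (A - 1) * (lam * (z - y) + 1) ≤ (A - 1) * Real.exp (lam * (z - y)) := by gcongr
        have : (A - 1) * (lam * (z - y) + 1) = α * (z - y) + (A - 1) := by rw [← hlam]; ring
        linarith
      rw [if_pos h1]
      by_cases h2 : r < z - y
      · rw [if_pos h2, if_pos (by linarith)]
        have : (A - 1) * Real.exp (lam * r) * (K - Real.exp (lam * (z - (y + r)))) =
            (A - 1) * (Real.exp (lam * r) * K) - (A - 1) * Real.exp (lam * (z - y)) := by
          have : Real.exp (lam * (z - y)) =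
              Real.exp (lam * r) * Real.exp (lam * (z - (y + r))) := by
            rw [← Real.exp_add]; ring_nf
          rw [this]; ring
        linarith
      · rw [if_neg h2, if_neg (by linarith)]
        linarith
    · rw [if_neg h1, if_neg (by linarith)]
      split_ifs with h2
      · have : Real.exp (α * d) ≤ Real.exp (α * (y - z)) := by
          gcongr
          linarith
        linarith
      · linarith
  have hi1 : IntegrableOn (fun z => (A - 1) * Real.exp (lam * r) *
      (K - Real.exp (lam * (z - (y + r))))) (Set.Ioi (y + r)) F :=
    (((integrable_const _).sub hint2).const_mul _).integrableOn
  have hi3 : Integrable (fun z => value α lam A K d (chainStep d (r, y) z)) F := by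
    refine Integrable.of_bound ?_ K ?_
    · exact ((measurable_value α lam A K d).comp
        ((measurable_chainStep d).comp (by fun_prop : Measurable fun z : ℝ =>
          (((r, y), z) : (ℝ × ℝ) × ℝ)))).aestronglyMeasurable
    · filter_upwards with z
      rw [Real.norm_eq_abs, abs_of_nonneg (value_nonneg hα hA1 hA.ge (by linarith) _)]
      refine value_le hα hlam0 hA1 hK1 ?_
      rw [chainStep]
      split_ifs
      · exact le_max_right _ _
      · exact hs
  have hsum : A - Real.exp (α * y) ≤
      (A - 1) * Real.exp (lam * r) * ∫ z, value α lam A K d (chainStep d (r, y) z) ∂F := by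
    rw [← integral_const_mul]
    refine le_trans ?_ (integral_mono ?_ (hi3.const_mul _) key)
    · rw [integral_add, integral_indicator measurableSet_Ioi,
        integral_sub (integrable_const _) hint, hval, integral_const_mul]
      · have := mul_nonneg (by positivity : 0 ≤ (A - 1) * Real.exp (lam * r))
          (hK (y + r) (by linarith))
        simp only [integral_const, probReal_univ, one_smul]
        linarith
      · exact hi1.integrable_indicator measurableSet_Ioi
      · exact (integrable_const _).sub hint
    · exact (hi1.integrable_indicator measurableSet_Ioi).add ((integrable_const _).sub hint)
  rw [value_of_alive ⟨hr, hy⟩]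
  simp only
  rw [neg_mul, Real.exp_neg, inv_mul_eq_div, div_div, div_le_iff₀ (by positivity)]
  linarith


/-! ### Optional stopping for i.i.d. increments -/

lemma chain_congr {d x : ℝ} {z z' : ℕ → ℝ} {n : ℕ} (h : ∀ i < n, z i = z' i) :
    chain d x z n = chain d x z' n := by
  induction n with
  | zero => rfl
  | succ n ih =>
    rw [chain, chain, ih fun i hi => h i (hi.trans n.lt_succ_self), h n n.lt_succ_self]

lemma measurable_chain (d x : ℝ) (n : ℕ) : Measurable fun z : ℕ → ℝ => chain d x z n := by
  induction n with
  | zero => exact measurable_const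
  | succ n ih => exact (measurable_chainStep d).comp (ih.prodMk (measurable_pi_apply n))

section IID

variable {Ω : Type*} [MeasurableSpace Ω] {P : Measure Ω} {X : ℕ → Ω → ℝ} {F : Measure ℝ}

lemma measurable_chain_comp (hX : ∀ i, Measurable (X i)) (d x : ℝ) (n : ℕ) :
    Measurable fun ω => chain d x (fun i => X i ω) n :=
  (measurable_chain d x n).comp (measurable_pi_lambda _ hX)

lemma measurableSet_exceeds (hX : ∀ i, Measurable (X i)) (d x : ℝ) :
    MeasurableSet {ω | Exceeds (partialSum fun i => X i ω) d x} := by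
  simp_rw [← exists_chain_fst_neg_iff, Set.ofPred_exists]
  exact MeasurableSet.iUnion fun n => measurableSet_lt
    (measurable_fst.comp (measurable_chain_comp hX d x n)) measurable_const

lemma tendsto_measure_chain_fst_neg (X : ℕ → Ω → ℝ) (d x : ℝ) :
    Filter.Tendsto (fun n => P {ω | (chain d x (fun i => X i ω) n).1 < 0}) Filter.atTop
      (nhds (P {ω | Exceeds (partialSum fun i => X i ω) d x})) := by
  simp_rw [← exists_chain_fst_neg_iff, Set.ofPred_exists]
  refine tendsto_measure_iUnion_atTop ?_
  intro n m hnm ω hω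
  simp only [Set.mem_ofPred_eq] at hω ⊢
  rwa [chain_eq_of_le _ hnm]
  exact fun h => absurd hω (not_lt.2 h.1)

/-- Increments are at most some `-ε < 0` with positive probability. By the second Borel–Cantelli
lemma over disjoint blocks, runs of `m` such increments occur for every `m`, and a run with `m * ε ≥
d` is a drawdown `d`. -/
lemma ae_nonempty_drawdownSet (hX : ∀ i, Measurable (X i)) (hX_law : ∀ i, HasLaw (X i) F P)
    (hX_indep : iIndepFun X P) (hF : 0 < F (Set.Iio 0)) :
    ∀ᵐ ω ∂P, ∀ d, (drawdownSet (partialSum fun i => X i ω) d).Nonempty := by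
  have := hX_indep.isProbabilityMeasure
  obtain ⟨ε, hε, hFε⟩ : ∃ ε > 0, 0 < F (Set.Iic (-ε)) := by
    by_contra! h
    have hU : (Set.Iio 0 : Set ℝ) = ⋃ n : ℕ, Set.Iic (-(1 / ((n : ℝ) + 1))) := by
      ext y
      simp only [Set.mem_Iio, Set.mem_iUnion, Set.mem_Iic]
      constructor
      · intro hy
        obtain ⟨n, hn⟩ := exists_nat_one_div_lt (neg_pos.2 hy)
        exact ⟨n, by linarith⟩
      · rintro ⟨n, hn⟩
        have : 0 < 1 / ((n : ℝ) + 1) := by positivity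
        linarith
    rw [hU] at hF
    exact hF.ne' (measure_iUnion_null fun n => nonpos_iff_eq_zero.1 (h _ (by positivity)))
  have hm : ∀ m : ℕ, ∀ᵐ ω ∂P, ∃ k : ℕ, ∀ j ∈ Finset.Ico (k * m) ((k + 1) * m), X j ω ≤ -ε := by
    intro m
    set s : ℕ → Set Ω := fun k => ⋂ j ∈ Finset.Ico (k * m) ((k + 1) * m), X j ⁻¹' Set.Iic (-ε)
    have hsm : ∀ k, MeasurableSet (s k) := fun k =>
      Finset.measurableSet_biInter _ fun j _ => hX j measurableSet_Iic
    have hprod := fun S : Finset ℕ => hX_indep.measure_inter_preimage_eq_mul S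
      (sets := fun _ => Set.Iic (-ε)) (fun _ _ => measurableSet_Iic)
    have hone : ∀ j, P (X j ⁻¹' Set.Iic (-ε)) = F (Set.Iic (-ε)) := fun j => by
      rw [← (hX_law j).map_eq, Measure.map_apply (hX j) measurableSet_Iic]
    have hind : iIndepSet s P := by
      rw [iIndepSet_iff_meas_biInter hsm]
      intro S
      have hdisj : (S : Set ℕ).PairwiseDisjoint fun k => Finset.Ico (k * m) ((k + 1) * m) := by
        intro k _ l _ hkl
        rw [Function.onFun, Finset.disjoint_left]
        intro j hj hj'
        rw [Finset.mem_Ico] at hj hj'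
        rcases lt_or_gt_of_ne hkl with h | h
        · have : (k + 1) * m ≤ l * m := Nat.mul_le_mul_right m h
          omega
        · have : (l + 1) * m ≤ k * m := Nat.mul_le_mul_right m h
          omega
      have := hprod (S.biUnion fun k => Finset.Ico (k * m) ((k + 1) * m))
      rw [Finset.prod_biUnion hdisj, Finset.set_biInter_biUnion] at this
      rw [this]
      exact Finset.prod_congr rfl fun k _ => (hprod _).symm
    have hsP : ∀ k, P (s k) = F (Set.Iic (-ε)) ^ m := fun k => by
      have : (k + 1) * m - k * m = m := by rw [add_mul, one_mul, Nat.add_sub_cancel_left]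
      rw [hprod]
      simp [hone, this]
    have h1 := measure_limsup_eq_one hsm hind (by
      simp_rw [hsP]
      exact ENNReal.tsum_const_eq_top_of_ne_zero (pow_ne_zero _ hFε.ne'))
    have h2 : ∀ᵐ ω ∂P, ω ∈ Filter.limsup s Filter.atTop :=
      (prob_compl_eq_zero_iff (MeasurableSet.measurableSet_limsup hsm)).2 h1
    filter_upwards [h2] with ω hω
    rw [Filter.mem_limsup_iff_frequently_mem] at hω
    obtain ⟨k, hk⟩ := hω.exists
    exact ⟨k, fun j hj => by simpa using Set.mem_iInter₂.1 hk j hj⟩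
  rw [← ae_all_iff] at hm
  filter_upwards [hm] with ω hω d
  obtain ⟨m, hm⟩ := exists_nat_ge (d / ε)
  obtain ⟨k, hk⟩ := hω m
  refine ⟨(k + 1) * m, mem_drawdownSet_nat.2 ⟨k * m, Nat.mul_le_mul_right m k.le_succ, ?_⟩⟩
  have h1 : partialSum (fun i => X i ω) ((k + 1) * m) - partialSum (fun i => X i ω) (k * m) =
      ∑ j ∈ Finset.Ico (k * m) ((k + 1) * m), X j ω :=
    (Finset.sum_Ico_eq_sub _ (Nat.mul_le_mul_right m k.le_succ)).symm
  have h2 := Finset.sum_le_card_nsmul _ _ _ hk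
  have : (k + 1) * m - k * m = m := by rw [add_mul, one_mul, Nat.add_sub_cancel_left]
  rw [Nat.card_Ico, this, nsmul_eq_mul] at h2
  rw [div_le_iff₀ hε] at hm
  linarith

lemma indepFun_chain (hX : ∀ i, Measurable (X i)) (hX_indep : iIndepFun X P) (d x : ℝ) (n : ℕ) :
    IndepFun (fun ω => chain d x (fun i => X i ω) n) (X n) P := by
  have h := hX_indep.indepFun_finset (Finset.range n) {n} (by simp) hX
  set φ : ((Finset.range n) → ℝ) → (ℕ → ℝ) :=
    -- Extending by `0` is harmless: the chain at time `n` reads only the first `n` increments.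
    fun v i => if hi : i ∈ Finset.range n then v ⟨i, hi⟩ else 0 with hφ
  have hφm : Measurable φ := by
    refine measurable_pi_lambda _ fun i => ?_
    by_cases hi : i ∈ Finset.range n
    · simp only [hφ, hi, dite_true]
      exact measurable_pi_apply _
    · simp only [hφ, hi, dite_false]
      exact measurable_const
  have hψ : Measurable fun v : ({n} : Finset ℕ) → ℝ => v ⟨n, Finset.mem_singleton_self n⟩ :=
    measurable_pi_apply _
  have h2 := h.comp ((measurable_chain d x n).comp hφm) hψ
  convert h2 using 1
  · ext1 ω
    refine chain_congr fun i hi => ?_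
    simp [hφ, hi]
  · rfl

variable [IsProbabilityMeasure P] [IsProbabilityMeasure F]

/-- The chain at time `n` is independent of `X n`, so Fubini expresses the next expectation through
the transition kernel. -/
lemma integral_value_chain_succ (hX : ∀ i, Measurable (X i)) (hX_law : ∀ i, HasLaw (X i) F P)
    (hX_indep : iIndepFun X P) (d x : ℝ) (n : ℕ) {V : ℝ × ℝ → ℝ} (hV : Measurable V) {K : ℝ}
    (hVK : ∀ s, 0 ≤ s.2 → |V s| ≤ K) :
    Integrable (fun s => ∫ z, V (chainStep d s z) ∂F)
      (P.map fun ω => chain d x (fun i => X i ω) n) ∧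
    ∫ ω, V (chain d x (fun i => X i ω) (n + 1)) ∂P =
      ∫ s, ∫ z, V (chainStep d s z) ∂F ∂(P.map fun ω => chain d x (fun i => X i ω) n) := by
  have hC := measurable_chain_comp hX d x n
  set C := fun ω => chain d x (fun i => X i ω) n
  have : IsProbabilityMeasure (P.map C) := Measure.isProbabilityMeasure_map hC.aemeasurable
  have hm := (indepFun_chain hX hX_indep d x n).map_prod_eq_prod_map_map hC.aemeasurable
    (hX n).aemeasurable
  rw [(hX_law n).map_eq] at hm
  have hVs : Measurable fun p : (ℝ × ℝ) × ℝ => V (chainStep d p.1 p.2) :=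
    hV.comp (measurable_chainStep d)
  have hint : Integrable (fun p : (ℝ × ℝ) × ℝ => V (chainStep d p.1 p.2)) ((P.map C).prod F) := by
    rw [← hm, integrable_map_measure hVs.aestronglyMeasurable (hC.prodMk (hX n)).aemeasurable]
    refine Integrable.of_bound
      (hVs.comp (hC.prodMk (hX n))).aestronglyMeasurable K (Filter.Eventually.of_forall fun ω => ?_)
    exact hVK _ (chain_snd_nonneg d x (fun i => X i ω) (n + 1))
  refine ⟨hint.integral_prod_left, ?_⟩
  rw [← integral_prod _ hint, ← hm,
    integral_map (hC.prodMk (hX n)).aemeasurable hVs.aestronglyMeasurable]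
  rfl

lemma integral_value_chain_le (hX : ∀ i, Measurable (X i)) (hX_law : ∀ i, HasLaw (X i) F P)
    (hX_indep : iIndepFun X P) (d x : ℝ) {V : ℝ × ℝ → ℝ} (hV : Measurable V) {K : ℝ}
    (hVK : ∀ s, 0 ≤ s.2 → |V s| ≤ K)
    (hstep : ∀ s, 0 ≤ s.2 → ∫ z, V (chainStep d s z) ∂F ≤ V s) (n : ℕ) :
    ∫ ω, V (chain d x (fun i => X i ω) n) ∂P ≤ V (x, 0) := by
  induction n with
  | zero => simp [chain]
  | succ n ih =>
    have hC := measurable_chain_comp hX d x n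
    obtain ⟨h1, h2⟩ := integral_value_chain_succ hX hX_law hX_indep d x n hV hVK
    refine le_trans ?_ ih
    rw [h2, integral_map hC.aemeasurable h1.aestronglyMeasurable]
    rw [integrable_map_measure h1.aestronglyMeasurable hC.aemeasurable] at h1
    refine integral_mono h1 (Integrable.of_bound (hV.comp hC).aestronglyMeasurable K
      (Filter.Eventually.of_forall fun ω => hVK _ (chain_snd_nonneg _ _ _ _))) fun ω => ?_
    exact hstep _ (chain_snd_nonneg _ _ _ _)

/-- The probability of exceeding `x` before a drawdown `d`, bounded above. -/
lemma measure_exceeds_le (hX : ∀ i, Measurable (X i)) (hX_law : ∀ i, HasLaw (X i) F P)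
    (hX_indep : iIndepFun X P) {α c κ A lam d : ℝ} (hα : 0 < α)
    (hlam : 0 < lam) (hA : c * (lam + α) = A * lam) (hd : 0 < d) (hκ : A = κ * Real.exp (α * d))
    (hκ1 : 1 ≤ κ)
    (hα_int : Integrable (fun y : ℝ => Real.exp (-α * y)) F)
    (hα_eq : ∫ y, Real.exp (-α * y) ∂F = 1)
    (Hup : ∀ x, 0 ≤ x → 0 ≤ ∫ z in Set.Ioi x, (Real.exp (-α * (z - x)) - c) ∂F)
    (Hdown : ∀ x < 0, ∫ z in Set.Iic x, (Real.exp (α * (x - z)) - κ) ∂F ≤ 0)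
    {x : ℝ} (hx : 0 ≤ x) :
    P {ω | Exceeds (partialSum fun i => X i ω) d x} ≤ ENNReal.ofReal (Real.exp (-lam * x)) := by
  have hexp : 1 < Real.exp (α * d) := Real.one_lt_exp_iff.2 (by positivity)
  have hA2 : Real.exp (α * d) ≤ A := by
    rw [hκ]; exact le_mul_of_one_le_left (Real.exp_pos _).le hκ1
  have hA1 : 1 < A := hexp.trans_le hA2
  have hA' : A - 1 ≠ 0 := by linarith
  refine le_of_tendsto' (tendsto_measure_chain_fst_neg X d x) fun n => ?_
  have hC := measurable_chain_comp hX d x n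
  have hV := measurable_value α lam A 1 d
  have hV0 := value_nonneg (lam := lam) hα hA1 hA2 zero_le_one
  have hVK : ∀ s : ℝ × ℝ, 0 ≤ s.2 → |value α lam A 1 d s| ≤ 1 := fun s hs => by
    rw [abs_of_nonneg (hV0 s)]
    exact value_le hα hlam hA1 le_rfl hs
  have h1 := integral_value_chain_le hX hX_law hX_indep d x hV hVK
    (fun s hs => integral_value_chainStep_le hα hlam hA hd hκ hA1 hα_int hα_eq Hup Hdown hs) n
  have h2 : value α lam A 1 d (x, 0) = Real.exp (-lam * x) := by
    rw [value_of_alive ⟨hx, hd⟩]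
    simp [div_self hA']
  rw [h2] at h1
  have hS : MeasurableSet {ω | (chain d x (fun i => X i ω) n).1 < 0} :=
    measurableSet_lt (measurable_fst.comp hC) measurable_const
  rw [← ofReal_measureReal]
  -- The value is `1` once the level is exceeded and nonnegative elsewhere, so it dominates the
  -- indicator.
  refine ENNReal.ofReal_le_ofReal (le_trans ?_ h1)
  rw [← integral_indicator_one hS]
  refine integral_mono ((integrable_const (1 : ℝ)).indicator hS)
    (Integrable.of_bound (hV.comp hC).aestronglyMeasurable 1
      (Filter.Eventually.of_forall fun ω => hVK _ (chain_snd_nonneg _ _ _ _))) fun ω => ?_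
  simp only [Set.indicator, Set.mem_ofPred_eq, Pi.one_apply]
  split_ifs with h
  · simp [value, h]
  · exact hV0 _

/-- The probability of exceeding `x` before a drawdown `d`, bounded below. -/
lemma le_measure_exceeds (hX : ∀ i, Measurable (X i)) (hX_law : ∀ i, HasLaw (X i) F P)
    (hX_indep : iIndepFun X P)
    (hdd : ∀ᵐ ω ∂P, ∀ d, (drawdownSet (partialSum fun i => X i ω) d).Nonempty)
    {α A lam d K : ℝ} (hα : 0 < α)
    (hlam : lam * (A - 1) = α) (hd : 0 < d) (hA : A = Real.exp (α * d))
    (hα_int : Integrable (fun y : ℝ => Real.exp (-α * y)) F)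
    (hα_eq : ∫ y, Real.exp (-α * y) ∂F = 1)
    (hlam_int : Integrable (fun y : ℝ => Real.exp (lam * y)) F)
    (hK1 : 1 ≤ K)
    (hK : ∀ x, 0 ≤ x → 0 ≤ ∫ z in Set.Ioi x, (K - Real.exp (lam * (z - x))) ∂F)
    {x : ℝ} (hx : 0 ≤ x) :
    ENNReal.ofReal (Real.exp (-lam * x) / K) ≤
      P {ω | Exceeds (partialSum fun i => X i ω) d x} := by
  have hA1 : 1 < A := by
    rw [hA]; exact Real.one_lt_exp_iff.2 (by positivity)
  have hA' : A - 1 ≠ 0 := by linarith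
  have hlam0 : 0 < lam := by
    by_contra! h
    nlinarith
  have hV := measurable_value α lam A K d
  have hV0 := value_nonneg (lam := lam) hα hA1 hA.ge (by linarith : 0 ≤ K)
  have hVK : ∀ s : ℝ × ℝ, 0 ≤ s.2 → |value α lam A K d s| ≤ K := fun s hs => by
    rw [abs_of_nonneg (hV0 s)]
    exact value_le hα hlam0 hA1 hK1 hs
  have h2 : value α lam A K d (x, 0) = Real.exp (-lam * x) := by
    rw [value_of_alive ⟨hx, hd⟩]
    simp [div_self hA']
  have hVm : ∀ n, Integrable (fun ω => value α lam A K d (chain d x (fun i => X i ω) n)) P :=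
    fun n => Integrable.of_bound (hV.comp (measurable_chain_comp hX d x n)).aestronglyMeasurable K
      (Filter.Eventually.of_forall fun ω => hVK _ (chain_snd_nonneg _ _ _ _))
  have h1 : ∀ n, Real.exp (-lam * x) ≤
      ∫ ω, value α lam A K d (chain d x (fun i => X i ω) n) ∂P := fun n => by
    -- The submartingale bound is the supermartingale bound for the negative of the value.
    have := integral_value_chain_le hX hX_law hX_indep d x (V := fun s => - value α lam A K d s)
      hV.neg (K := K) (fun s hs => by rw [abs_neg]; exact hVK s hs)
      (fun s hs => by
        rw [integral_neg]
        exact neg_le_neg (le_integral_value_chainStep hα hlam hd hA hα_int hα_eq hlam_int hK1 hK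
          hs)) n
    rw [integral_neg] at this
    rw [← h2]
    linarith
  -- Every drawdown is achieved almost surely, so the chain is eventually frozen, with value `K` on
  -- the exceedance event and `0` off it.
  have h3 : Filter.Tendsto (fun n => ∫ ω, value α lam A K d (chain d x (fun i => X i ω) n) ∂P)
      Filter.atTop (nhds (∫ ω, {ω | Exceeds (partialSum fun i => X i ω) d x}.indicator
        (fun _ => K) ω ∂P)) := by
    refine tendsto_integral_of_dominated_convergence (fun _ => K)
      (fun n => (hVm n).aestronglyMeasurable) (integrable_const _)
      (fun n => Filter.Eventually.of_forall fun ω => hVK _ (chain_snd_nonneg _ _ _ _)) ?_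
    filter_upwards [hdd] with ω hω
    obtain ⟨n, hn⟩ := chain_eventually_stopped (x := x) (fun i => X i ω) (hω d)
    refine tendsto_const_nhds.congr' ?_
    filter_upwards [Filter.eventually_ge_atTop n] with N hN
    rw [value_of_stopped (hn N hN)]
    simp only [Set.indicator, Set.mem_ofPred_eq]
    congr 1
    rw [← exists_chain_fst_neg_iff]
    apply propext
    constructor
    · rintro ⟨m, hm⟩
      rcases le_total m N with h | h
      · rwa [chain_eq_of_le _ h]
        exact fun hh => absurd hm (not_lt.2 hh.1)
      · rwa [chain_eq_of_le (hn N hN) h] at hm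
    · exact fun h => ⟨N, h⟩
  have h4 := ge_of_tendsto' h3 h1
  rw [integral_indicator_const _ (measurableSet_exceeds hX d x), smul_eq_mul] at h4
  rw [← ofReal_measureReal]
  refine ENNReal.ofReal_le_ofReal ?_
  rw [div_le_iff₀ (by linarith)]
  exact h4

end IID


/-! ### Exponential tails, and tail conditions extracted from `dPlus` and `dMinus` -/

lemma expMeasure_Ioi {r : ℝ} (hr : 0 < r) (x : ℝ) :
    expMeasure r (Set.Ioi x) = if 0 ≤ x then ENNReal.ofReal (Real.exp (-r * x)) else 1 := by
  have := isProbabilityMeasure_expMeasure hr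
  rw [← Set.compl_Iic, prob_compl_eq_one_sub measurableSet_Iic, ← ofReal_cdf,
    cdf_expMeasure_eq hr]
  split_ifs with h
  · rw [← ENNReal.ofReal_one, ← ENNReal.ofReal_sub _ (by
      rw [sub_nonneg, Real.exp_le_one_iff]; nlinarith)]
    congr 1
    rw [neg_mul]
    ring
  · simp

lemma integral_cond_eq (F : Measure ℝ) [IsFiniteMeasure F] (s : Set ℝ) (f : ℝ → ℝ) :
    ∫ y, f y ∂(cond F s) = (F.real s)⁻¹ * ∫ y in s, f y ∂F := by
  rw [ProbabilityTheory.cond, integral_smul_measure, ENNReal.toReal_inv, smul_eq_mul]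
  rfl

lemma integrable_exp_mul_sub {F : Measure ℝ} {α : ℝ}
    (hα_int : Integrable (fun y : ℝ => Real.exp (-α * y)) F)
    (x : ℝ) : Integrable (fun z => Real.exp (α * (x - z))) F := by
  have : (fun z => Real.exp (α * (x - z))) = fun z => Real.exp (α * x) * Real.exp (-α * z) := by
    ext z; rw [← Real.exp_add]; ring_nf
  rw [this]
  exact hα_int.const_mul _

section Tails

variable {F : Measure ℝ} [IsProbabilityMeasure F]

lemma cdf_lt_one_iff {x : ℝ} : cdf F x < 1 ↔ 0 < F (Set.Ioi x) := by
  rw [← Set.compl_Iic, prob_compl_eq_one_sub measurableSet_Iic, tsub_pos_iff_lt, ← ofReal_cdf,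
    ENNReal.ofReal_lt_one]

lemma cdf_pos_iff {x : ℝ} : 0 < cdf F x ↔ 0 < F (Set.Iic x) := by
  rw [← ofReal_cdf, ENNReal.ofReal_pos]

lemma coe_lt_essSupremum {x : ℝ} (hx : 0 < F (Set.Ioi x)) : (x : EReal) < essSupremum F := by
  have hU : (Set.Ioi x : Set ℝ) = ⋃ n : ℕ, Set.Ioi (x + 1 / ((n : ℝ) + 1)) := by
    ext y
    simp only [Set.mem_Ioi, Set.mem_iUnion]
    constructor
    · intro hy
      obtain ⟨n, hn⟩ := exists_nat_one_div_lt (sub_pos.2 hy)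
      exact ⟨n, by linarith⟩
    · rintro ⟨n, hn⟩
      have : 0 < 1 / ((n : ℝ) + 1) := by positivity
      linarith
  rw [hU] at hx
  obtain ⟨n, hn⟩ : ∃ n : ℕ, 0 < F (Set.Ioi (x + 1 / ((n : ℝ) + 1))) := by
    by_contra! h
    exact hx.ne' (measure_iUnion_null fun n => nonpos_iff_eq_zero.1 (h n))
  have h1 : ((x + 1 / ((n : ℝ) + 1) : ℝ) : EReal) ≤ essSupremum F :=
    le_sSup ⟨_, cdf_lt_one_iff.2 hn, rfl⟩
  refine lt_of_lt_of_le (EReal.coe_lt_coe_iff.2 ?_) h1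
  have : 0 < 1 / ((n : ℝ) + 1) := by positivity
  linarith

lemma measure_Ici_pos {x : ℝ} (hx : (x : EReal) < essSupremum F) : 0 < F (Set.Ici x) := by
  obtain ⟨_, ⟨y, hy, rfl⟩, hxy⟩ := lt_sSup_iff.1 hx
  refine (cdf_lt_one_iff.1 hy).trans_le (measure_mono ?_)
  have h : x < y := EReal.coe_lt_coe_iff.1 hxy
  intro z hz
  exact h.le.trans (le_of_lt hz)

lemma measure_Iio_pos {x : ℝ} (hx : essInfimum F < (x : EReal)) : 0 < F (Set.Iio x) := by
  obtain ⟨_, ⟨y, hy, rfl⟩, hxy⟩ := sInf_lt_iff.1 hx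
  refine (cdf_pos_iff.1 hy).trans_le (measure_mono ?_)
  have h : y < x := EReal.coe_lt_coe_iff.1 hxy
  intro z hz
  exact lt_of_le_of_lt hz h

lemma measure_Iio_eq_zero {x : ℝ} (hx : ¬ essInfimum F < (x : EReal)) : F (Set.Iio x) = 0 := by
  have hU : (Set.Iio x : Set ℝ) = ⋃ n : ℕ, Set.Iic (x - 1 / ((n : ℝ) + 1)) := by
    ext y
    simp only [Set.mem_Iio, Set.mem_iUnion, Set.mem_Iic]
    constructor
    · intro hy
      obtain ⟨n, hn⟩ := exists_nat_one_div_lt (sub_pos.2 hy)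
      exact ⟨n, by linarith⟩
    · rintro ⟨n, hn⟩
      have : 0 < 1 / ((n : ℝ) + 1) := by positivity
      linarith
  rw [hU]
  refine measure_iUnion_null fun n => ?_
  by_contra h
  refine hx (lt_of_le_of_lt (sInf_le ⟨_, cdf_pos_iff.2 (pos_iff_ne_zero.2 h), rfl⟩)
    (EReal.coe_lt_coe_iff.2 ?_))
  have : 0 < 1 / ((n : ℝ) + 1) := by positivity
  linarith

lemma le_of_mul_iSup_le {α t : ℝ} (hα : 0 < α) {S : EReal}
    (h : ((1 / α : ℝ) : EReal) * S ≤ (t : EReal)) : S ≤ ((α * t : ℝ) : EReal) := by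
  have h1 : ((α : ℝ) : EReal) * (((1 / α : ℝ) : EReal) * S) = S := by
    rw [← mul_assoc, ← EReal.coe_mul, mul_one_div_cancel hα.ne', EReal.coe_one, one_mul]
  rw [← h1, EReal.coe_mul]
  exact mul_le_mul_of_nonneg_left h (by exact_mod_cast hα.le)

lemma integrableOn_exp_neg_Ici {α : ℝ} (hα : 0 < α) (x : ℝ) :
    IntegrableOn (fun z => Real.exp (-α * (z - x))) (Set.Ici x) F := by
  refine Integrable.of_bound (by fun_prop) 1 ?_
  filter_upwards [ae_restrict_mem measurableSet_Ici] with z hz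
  rw [Real.norm_eq_abs, abs_of_pos (Real.exp_pos _), Real.exp_le_one_iff]
  have : x ≤ z := hz
  nlinarith

lemma integral_Ici_nonneg_of_dPlus_le {α t : ℝ} (hα : 0 < α) (ht : 0 ≤ t)
    (h : dPlus F α ≤ (t : EReal)) {x : ℝ} (hx : 0 < x) :
    0 ≤ ∫ z in Set.Ici x, (Real.exp (-α * (z - x)) - Real.exp (-(α * t))) ∂F := by
  by_cases hes : (x : EReal) < essSupremum F
  · have h1 := (le_iSup₂ (f := fun (x : ℝ) (_ : 0 < x ∧ (x : EReal) < essSupremum F) =>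
      ((-Real.log (∫ y, Real.exp (-α * (y - x)) ∂(cond F (Set.Ici x))) : ℝ) : EReal)) x
      ⟨hx, hes⟩).trans (le_of_mul_iSup_le hα h)
    have h2 := EReal.coe_le_coe_iff.1 h1
    have hpos : 0 < F.real (Set.Ici x) :=
      ENNReal.toReal_pos (measure_Ici_pos hes).ne' (measure_ne_top _ _)
    have hJ : 0 < ∫ y in Set.Ici x, Real.exp (-α * (y - x)) ∂F :=
      integral_exp_pos (μ := F.restrict (Set.Ici x)) (hμ := ⟨by
        rw [Ne, Measure.restrict_eq_zero]; exact (measure_Ici_pos hes).ne'⟩)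
        (integrableOn_exp_neg_Ici hα x)
    have h3 : Real.exp (-(α * t)) ≤ ∫ y, Real.exp (-α * (y - x)) ∂(cond F (Set.Ici x)) := by
      rw [← Real.le_log_iff_exp_le]
      · linarith
      · rw [integral_cond_eq]
        positivity
    rw [integral_cond_eq, inv_mul_eq_div, le_div_iff₀ hpos] at h3
    rw [integral_sub (integrableOn_exp_neg_Ici hα x) (integrable_const _)]
    simp only [integral_const, measureReal_restrict_apply_univ, smul_eq_mul]
    linarith
  · have hnull : F (Set.Ioi x) = 0 := by
      by_contra h'
      exact hes (coe_lt_essSupremum (pos_iff_ne_zero.2 h'))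
    -- At or beyond the essential supremum only a possible atom at `x` is left, where the overshoot
    -- is `0`.
    refine setIntegral_nonneg_of_ae_restrict ?_
    have h4 : ∀ᵐ z ∂F, ¬ x < z := by
      rw [ae_iff]
      simpa [Set.Ioi] using hnull
    filter_upwards [ae_restrict_mem measurableSet_Ici, ae_restrict_of_ae h4] with z hz hz'
    have : z = x := le_antisymm (not_lt.1 hz') hz
    simp only [Pi.zero_apply]
    rw [this, sub_self, mul_zero, Real.exp_zero, sub_nonneg, Real.exp_le_one_iff]
    have := mul_nonneg hα.le ht
    linarith

lemma tendsto_add_one_div_nat (x : ℝ) :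
    Filter.Tendsto (fun n : ℕ => x + 1 / ((n : ℝ) + 1)) Filter.atTop (nhds x) := by
  simpa using tendsto_one_div_add_atTop_nhds_zero_nat.const_add x

/-- `dPlus` bounds the overshoot over nonnegative levels. -/
lemma integral_Ioi_nonneg_of_dPlus_le {α t : ℝ} (hα : 0 < α) (ht : 0 ≤ t)
    (h : dPlus F α ≤ (t : EReal)) (x : ℝ) (hx : 0 ≤ x) :
    0 ≤ ∫ z in Set.Ioi x, (Real.exp (-α * (z - x)) - Real.exp (-(α * t))) ∂F := by
  -- Approaching `x` from above gives the level `x = 0`, outside the supremum defining `dPlus`, and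
  -- turns closed half-lines into the open one.
  set u : ℕ → ℝ := fun n => x + 1 / ((n : ℝ) + 1)
  have hu : ∀ n, x < u n := fun n => by
    have : 0 < 1 / ((n : ℝ) + 1) := by positivity
    simp only [u]
    linarith
  have hlim : Filter.Tendsto (fun n => ∫ z in Set.Ici (u n),
      (Real.exp (-α * (z - u n)) - Real.exp (-(α * t))) ∂F) Filter.atTop
      (nhds (∫ z in Set.Ioi x, (Real.exp (-α * (z - x)) - Real.exp (-(α * t))) ∂F)) := by
    simp_rw [← integral_indicator measurableSet_Ici]
    rw [← integral_indicator measurableSet_Ioi]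
    refine tendsto_integral_of_dominated_convergence (fun _ => 1 + Real.exp (-(α * t)))
      (fun n => ((Measurable.indicator (by fun_prop) measurableSet_Ici)).aestronglyMeasurable)
      (integrable_const _) (fun n => Filter.Eventually.of_forall fun z => ?_)
      (Filter.Eventually.of_forall fun z => ?_)
    · simp only [Set.indicator, Set.mem_Ici]
      split_ifs with hz
      · refine (norm_sub_le _ _).trans ?_
        rw [Real.norm_eq_abs, Real.norm_eq_abs, abs_of_pos (Real.exp_pos _),
          abs_of_pos (Real.exp_pos _)]
        gcongr
        rw [Real.exp_le_one_iff]
        nlinarith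
      · rw [norm_zero]
        positivity
    · rcases lt_or_ge x z with hz | hz
      · have hev : ∀ᶠ n in Filter.atTop, u n < z := (tendsto_add_one_div_nat x).eventually_lt_const hz
        rw [Set.indicator_of_mem (Set.mem_Ioi.2 hz)]
        have : Filter.Tendsto (fun n => Real.exp (-α * (z - u n)) - Real.exp (-(α * t)))
            Filter.atTop (nhds (Real.exp (-α * (z - x)) - Real.exp (-(α * t)))) := by
          have hc : Continuous fun y => Real.exp (-α * (z - y)) - Real.exp (-(α * t)) := by
            fun_prop
          exact (hc.tendsto x).comp (tendsto_add_one_div_nat x)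
        refine this.congr' ?_
        filter_upwards [hev] with n hn
        rw [Set.indicator_of_mem (Set.mem_Ici.2 hn.le)]
      · rw [Set.indicator_of_notMem (by simpa using hz)]
        refine tendsto_const_nhds.congr fun n => ?_
        rw [Set.indicator_of_notMem]
        simpa using hz.trans_lt (hu n)
  exact ge_of_tendsto' hlim fun n => integral_Ici_nonneg_of_dPlus_le hα ht h (hx.trans_lt (hu n))

lemma integral_Iio_nonpos_of_dMinus_le {α t : ℝ} (hα : 0 < α)
    (hα_int : Integrable (fun y : ℝ => Real.exp (-α * y)) F)
    (h : dMinus F α ≤ (t : EReal)) {x : ℝ} (hx : x < 0) :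
    ∫ z in Set.Iio x, (Real.exp (α * (x - z)) - Real.exp (α * t)) ∂F ≤ 0 := by
  by_cases hei : essInfimum F < (x : EReal)
  · have h1 := (le_iSup₂ (f := fun (x : ℝ) (_ : essInfimum F < (x : EReal) ∧ x < 0) =>
      ((Real.log (∫ y, Real.exp (α * (x - y)) ∂(cond F (Set.Iio x))) : ℝ) : EReal)) x
      ⟨hei, hx⟩).trans (le_of_mul_iSup_le hα h)
    have h2 := EReal.coe_le_coe_iff.1 h1
    have hpos : 0 < F.real (Set.Iio x) :=
      ENNReal.toReal_pos (measure_Iio_pos hei).ne' (measure_ne_top _ _)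
    have hJ : 0 < ∫ y in Set.Iio x, Real.exp (α * (x - y)) ∂F :=
      integral_exp_pos (μ := F.restrict (Set.Iio x)) (hμ := ⟨by
        rw [Ne, Measure.restrict_eq_zero]; exact (measure_Iio_pos hei).ne'⟩)
        (integrable_exp_mul_sub hα_int x).integrableOn
    have h3 : ∫ y, Real.exp (α * (x - y)) ∂(cond F (Set.Iio x)) ≤ Real.exp (α * t) := by
      rwa [← Real.log_le_iff_le_exp]
      rw [integral_cond_eq]
      positivity
    rw [integral_cond_eq, inv_mul_eq_div, div_le_iff₀ hpos] at h3
    rw [integral_sub (integrable_exp_mul_sub hα_int x).integrableOn (integrable_const _)]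
    simp only [integral_const, measureReal_restrict_apply_univ, smul_eq_mul]
    linarith
  · rw [Measure.restrict_eq_zero.2 (measure_Iio_eq_zero hei), integral_zero_measure]

/-- `dMinus` bounds the undershoot below negative levels. -/
lemma integral_Iic_nonpos_of_dMinus_le {α t : ℝ} (hα : 0 < α)
    (hα_int : Integrable (fun y : ℝ => Real.exp (-α * y)) F)
    (h : dMinus F α ≤ (t : EReal)) (x : ℝ) (hx : x < 0) :
    ∫ z in Set.Iic x, (Real.exp (α * (x - z)) - Real.exp (α * t)) ∂F ≤ 0 := by
  set u : ℕ → ℝ := fun n => x + 1 / ((n : ℝ) + 1)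
  have hu : ∀ n, x < u n := fun n => by
    have : 0 < 1 / ((n : ℝ) + 1) := by positivity
    simp only [u]
    linarith
  -- The approximating levels must be negative both for `dMinus` to apply and for `exp (-α * z)` to
  -- dominate.
  have hu0 : ∀ᶠ n in Filter.atTop, u n < 0 := (tendsto_add_one_div_nat x).eventually_lt_const hx
  have hlim : Filter.Tendsto (fun n => ∫ z in Set.Iio (u n),
      (Real.exp (α * (u n - z)) - Real.exp (α * t)) ∂F) Filter.atTop
      (nhds (∫ z in Set.Iic x, (Real.exp (α * (x - z)) - Real.exp (α * t)) ∂F)) := by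
    simp_rw [← integral_indicator measurableSet_Iio]
    rw [← integral_indicator measurableSet_Iic]
    refine tendsto_integral_filter_of_dominated_convergence
      (fun z => Real.exp (-α * z) + Real.exp (α * t))
      (Filter.Eventually.of_forall fun n =>
        ((Measurable.indicator (by fun_prop) measurableSet_Iio)).aestronglyMeasurable)
      (hu0.mono fun n hn => Filter.Eventually.of_forall fun z => ?_)
      (hα_int.add (integrable_const _))
      (Filter.Eventually.of_forall fun z => ?_)
    · simp only [Set.indicator, Set.mem_Iio]
      split_ifs with hz
      · refine (norm_sub_le _ _).trans ?_
        rw [Real.norm_eq_abs, Real.norm_eq_abs, abs_of_pos (Real.exp_pos _),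
          abs_of_pos (Real.exp_pos _)]
        refine add_le_add (Real.exp_le_exp.2 ?_) le_rfl
        have := mul_pos_of_neg_of_neg hn (neg_lt_zero.2 hα)
        linarith
      · rw [norm_zero]
        positivity
    · rcases lt_or_ge x z with hz | hz
      · have hev : ∀ᶠ n in Filter.atTop, u n < z := (tendsto_add_one_div_nat x).eventually_lt_const hz
        rw [Set.indicator_of_notMem (by simpa using hz)]
        refine tendsto_const_nhds.congr' ?_
        filter_upwards [hev] with n hn
        rw [Set.indicator_of_notMem]
        simpa using hn.le
      · rw [Set.indicator_of_mem (Set.mem_Iic.2 hz)]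
        have : Filter.Tendsto (fun n => Real.exp (α * (u n - z)) - Real.exp (α * t))
            Filter.atTop (nhds (Real.exp (α * (x - z)) - Real.exp (α * t))) := by
          have hc : Continuous fun y => Real.exp (α * (y - z)) - Real.exp (α * t) := by
            fun_prop
          exact (hc.tendsto x).comp (tendsto_add_one_div_nat x)
        refine this.congr fun n => ?_
        rw [Set.indicator_of_mem (Set.mem_Iio.2 (hz.trans_lt (hu n)))]
  refine le_of_tendsto hlim ?_
  filter_upwards [hu0] with n hn using integral_Iio_nonpos_of_dMinus_le hα hα_int h hn

/-- One admissible level suffices, and a positive mean provides it. Nonnegativity of both suprema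
excludes `⊥`, so that `dZero` is finite exactly when both are. -/
lemma dPlus_nonneg {α : ℝ} (hα : 0 < α) (hF_mean : 0 < ∫ y, y ∂F) : 0 ≤ dPlus F α := by
  have hpos : 0 < F (Set.Ioi 0) := by
    by_contra h
    have h0 : F (Set.Ioi 0) = 0 := nonpos_iff_eq_zero.1 (not_lt.1 h)
    have h1 : ∀ᵐ z ∂F, ¬ (0 : ℝ) < z := by
      rw [ae_iff]
      simpa [Set.Ioi] using h0
    have : ∫ y, y ∂F ≤ 0 := integral_nonpos_of_ae (by filter_upwards [h1] with z hz; exact not_lt.1 hz)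
    linarith
  obtain ⟨x, hx0, hx⟩ := EReal.lt_iff_exists_real_btwn.1 (coe_lt_essSupremum hpos)
  refine mul_nonneg (by exact_mod_cast (by positivity : 0 ≤ 1 / α)) ?_
  refine le_trans ?_ (le_iSup₂ (f := fun (x : ℝ) (_ : 0 < x ∧ (x : EReal) < essSupremum F) =>
      ((-Real.log (∫ y, Real.exp (-α * (y - x)) ∂(cond F (Set.Ici x))) : ℝ) : EReal)) x
      ⟨EReal.coe_lt_coe_iff.1 hx0, hx⟩)
  rw [← EReal.coe_zero, EReal.coe_le_coe_iff, neg_nonneg]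
  refine Real.log_nonpos (integral_nonneg fun _ => (Real.exp_pos _).le) ?_
  have hpos : 0 < F.real (Set.Ici x) :=
      ENNReal.toReal_pos (measure_Ici_pos hx).ne' (measure_ne_top _ _)
  rw [integral_cond_eq, inv_mul_eq_div, div_le_one hpos]
  refine (setIntegral_mono_on (integrableOn_exp_neg_Ici hα x) (integrable_const (1 : ℝ))
    measurableSet_Ici fun z hz => ?_).trans ?_
  · rw [Real.exp_le_one_iff]
    have : x ≤ z := hz
    nlinarith
  · simp

lemma dMinus_nonneg {α : ℝ} (hα : 0 < α) (hF_neg : 0 < F (Set.Iio 0))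
    (hα_int : Integrable (fun y : ℝ => Real.exp (-α * y)) F) : 0 ≤ dMinus F α := by
  have hei : essInfimum F < ((0 : ℝ) : EReal) := by
    by_contra h
    exact hF_neg.ne' (measure_Iio_eq_zero h)
  obtain ⟨x, hx, hx0⟩ := EReal.lt_iff_exists_real_btwn.1 hei
  refine mul_nonneg (by exact_mod_cast (by positivity : 0 ≤ 1 / α)) ?_
  refine le_trans ?_ (le_iSup₂ (f := fun (x : ℝ) (_ : essInfimum F < (x : EReal) ∧ x < 0) =>
      ((Real.log (∫ y, Real.exp (α * (x - y)) ∂(cond F (Set.Iio x))) : ℝ) : EReal)) x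
      ⟨hx, EReal.coe_lt_coe_iff.1 hx0⟩)
  rw [← EReal.coe_zero, EReal.coe_le_coe_iff]
  refine Real.log_nonneg ?_
  have hpos : 0 < F.real (Set.Iio x) :=
      ENNReal.toReal_pos (measure_Iio_pos hx).ne' (measure_ne_top _ _)
  rw [integral_cond_eq, inv_mul_eq_div, one_le_div hpos]
  refine le_trans ?_ (setIntegral_mono_on (integrable_const (1 : ℝ))
    (integrable_exp_mul_sub hα_int x).integrableOn measurableSet_Iio fun z hz => ?_)
  · simp
  · refine Real.one_le_exp (mul_nonneg hα.le ?_)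
    have : z < x := hz
    linarith

end Tails

/-! ### The bounds for the random walk -/

section RandomWalk

variable {F : Measure ℝ} {Ω : Type*} [MeasurableSpace Ω] {P : Measure Ω} {X : ℕ → Ω → ℝ}

/-- `HasLaw` gives only almost everywhere measurability, whereas the chain estimates use measurable
increments. -/
lemma exists_measurable_version (hX_law : ∀ i, HasLaw (X i) F P) (hX_indep : iIndepFun X P) :
    ∃ X' : ℕ → Ω → ℝ, (∀ i, Measurable (X' i)) ∧ (∀ i, HasLaw (X' i) F P) ∧ iIndepFun X' P ∧
      ∀ᵐ ω ∂P, walk X ω = partialSum fun i => X' i ω := by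
  have hm := fun i => (hX_law i).aemeasurable
  refine ⟨fun i => (hm i).mk, fun i => (hm i).measurable_mk,
    fun i => (hX_law i).congr (hm i).ae_eq_mk.symm, hX_indep.congr fun i => (hm i).ae_eq_mk, ?_⟩
  filter_upwards [ae_all_iff.2 fun i => (hm i).ae_eq_mk] with ω hω
  ext n
  exact Finset.sum_congr rfl fun i _ => hω i

lemma aemeasurable_of_nullMeasurableSet_Ioi {f : Ω → ℝ}
    (h : ∀ x, NullMeasurableSet {ω | x < f ω} P) : AEMeasurable f P := by
  have : NullMeasurable f P := by
    have hm : @Measurable (NullMeasurableSpace Ω P) ℝ _ _ f := measurable_of_Ioi h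
    exact fun s hs => hm hs
  exact this.aemeasurable

/-- Almost surely the walk achieves every drawdown, and `M_d` exceeds `x` if and only if a measurable
version of the walk does so before the drawdown. -/
lemma ae_lt_maxBeforeDrawdown_iff (hX_law : ∀ i, HasLaw (X i) F P) (hX_indep : iIndepFun X P)
    (hF_neg : 0 < F (Set.Iio 0)) :
    ∃ X' : ℕ → Ω → ℝ, (∀ i, Measurable (X' i)) ∧ (∀ i, HasLaw (X' i) F P) ∧ iIndepFun X' P ∧
      ∀ᵐ ω ∂P, ∀ d, (drawdownSet (walk X ω) d).Nonempty ∧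
        ∀ x, (x < maxBeforeDrawdown (walk X ω) d ↔ Exceeds (partialSum fun i => X' i ω) d x) := by
  obtain ⟨X', h1, h2, h3, h4⟩ := exists_measurable_version hX_law hX_indep
  refine ⟨X', h1, h2, h3, ?_⟩
  filter_upwards [h4, ae_nonempty_drawdownSet h1 h2 h3 hF_neg] with ω hω hω' d
  rw [hω]
  exact ⟨hω' d, fun x => lt_maxBeforeDrawdown_iff (bddAbove_image_Iic_nat _) (hω' d)⟩

lemma aemeasurable_maxBeforeDrawdown_walk (hX_law : ∀ i, HasLaw (X i) F P)
    (hX_indep : iIndepFun X P) (hF_neg : 0 < F (Set.Iio 0)) (d : ℝ) :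
    AEMeasurable (fun ω => maxBeforeDrawdown (walk X ω) d) P := by
  obtain ⟨X', h1, -, -, h4⟩ := ae_lt_maxBeforeDrawdown_iff hX_law hX_indep hF_neg
  refine aemeasurable_of_nullMeasurableSet_Ioi fun x => ?_
  refine (measurableSet_exceeds h1 d x).nullMeasurableSet.congr ?_
  filter_upwards [h4] with ω hω
  exact propext ((hω d).2 x).symm

lemma maxBeforeDrawdown_walk_nonneg {Ω : Type*} (X : ℕ → Ω → ℝ) (d : ℝ) (ω : Ω) :
    0 ≤ maxBeforeDrawdown (walk X ω) d := by
  have : walk X ω ⊥ ≤ _ := le_maxBeforeDrawdown_bot (d := d) (bddAbove_image_Iic_nat (walk X ω))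
  simpa [walk] using this

variable [IsProbabilityMeasure F]

lemma measure_lt_maxBeforeDrawdown_walk_le [IsProbabilityMeasure P]
    (hX_law : ∀ i, HasLaw (X i) F P) (hX_indep : iIndepFun X P)
    (hF_mean : 0 < ∫ y, y ∂F) (hF_neg : 0 < F (Set.Iio 0)) {α : ℝ} (hα : 0 < α)
    (hα_int : Integrable (fun y : ℝ => Real.exp (-α * y)) F)
    (hα_eq : ∫ y, Real.exp (-α * y) ∂F = 1) {d D : ℝ} (hd : 0 < d)
    (hD : (D : EReal) = (d : EReal) + dZero F α) :
    d ≤ D ∧ ∀ x : ℝ, P {ω | x < maxBeforeDrawdown (walk X ω) d} ≤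
      expMeasure (α / (Real.exp (α * D) - 1)) (Set.Ioi x) := by
  have hp := dPlus_nonneg (F := F) hα hF_mean
  have hm := dMinus_nonneg (F := F) hα hF_neg hα_int
  obtain ⟨p, m, hp', hm'⟩ : ∃ p m : ℝ, dPlus F α = p ∧ dMinus F α = m := by
    unfold dZero at hD
    generalize dPlus F α = a at *
    generalize dMinus F α = b at *
    induction a with
    | bot => simp at hp
    | top =>
      rw [EReal.top_add_of_ne_bot (by rintro rfl; simp at hm)] at hD
      simp at hD
    | coe a =>
      induction b with
      | bot => simp at hm
      | top => simp at hD
      | coe b => exact ⟨a, b, rfl, rfl⟩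
  have hp0 : 0 ≤ p := by rw [hp'] at hp; exact_mod_cast hp
  have hm0 : 0 ≤ m := by rw [hm'] at hm; exact_mod_cast hm
  have hDe : D = d + (p + m) := by
    unfold dZero at hD
    rw [hp', hm'] at hD
    exact_mod_cast hD
  have hdD : d ≤ D := by linarith
  have hexp : 1 < Real.exp (α * D) := Real.one_lt_exp_iff.2 (mul_pos hα (by linarith))
  have hlam : 0 < α / (Real.exp (α * D) - 1) := div_pos hα (by linarith)
  refine ⟨hdD, fun x => ?_⟩
  rw [expMeasure_Ioi hlam]
  split_ifs with hx
  · obtain ⟨X', h1, h2, h3, h4⟩ := ae_lt_maxBeforeDrawdown_iff hX_law hX_indep hF_neg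
    have : {ω | x < maxBeforeDrawdown (walk X ω) d} =ᵐ[P]
        {ω | Exceeds (partialSum fun i => X' i ω) d x} := by
      filter_upwards [h4] with ω hω
      exact propext ((hω d).2 x)
    rw [measure_congr this]
    -- Here `κ = exp (α * m)` and `c = exp (-(α * p))`; the remaining goal is `c (lam + α) = A lam`,
    -- which holds because `A = c * exp (α * D)`.
    refine measure_exceeds_le (A := Real.exp (α * m) * Real.exp (α * d)) h1 h2 h3 hα hlam ?_ hd rfl
      (Real.one_le_exp (by positivity)) hα_int hα_eq
      (integral_Ioi_nonneg_of_dPlus_le hα hp0 hp'.le)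
      (integral_Iic_nonpos_of_dMinus_le hα hα_int hm'.le) hx
    have hB : Real.exp (α * D) =
        Real.exp (α * m) * Real.exp (α * d) * (Real.exp (-(α * p)))⁻¹ := by
      rw [← Real.exp_neg, ← Real.exp_add, ← Real.exp_add, hDe]
      ring_nf
    have hne : Real.exp (α * D) - 1 ≠ 0 := by linarith
    have hc := Real.exp_ne_zero (-(α * p))
    have hB' : Real.exp (α * m) * Real.exp (α * d) = Real.exp (α * D) * Real.exp (-(α * p)) := by
      rw [hB, inv_mul_cancel_right₀ hc]
    rw [hB']
    field_simp
    ring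
  · exact prob_le_one

lemma lintegral_maxBeforeDrawdown_walk_le [IsProbabilityMeasure P]
    (hX_law : ∀ i, HasLaw (X i) F P) (hX_indep : iIndepFun X P)
    (hF_mean : 0 < ∫ y, y ∂F) (hF_neg : 0 < F (Set.Iio 0)) {α : ℝ} (hα : 0 < α)
    (hα_int : Integrable (fun y : ℝ => Real.exp (-α * y)) F)
    (hα_eq : ∫ y, Real.exp (-α * y) ∂F = 1) {d : ℝ} (hd : 0 < d) :
    ∫⁻ ω, ENNReal.ofReal (maxBeforeDrawdown (walk X ω) d) ∂P ≤
      (EReal.exp ((α : EReal) * ((d : EReal) + dZero F α)) - 1) / ENNReal.ofReal α := by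
  have h0 : 0 ≤ dZero F α :=
    add_nonneg (dPlus_nonneg hα hF_mean) (dMinus_nonneg hα hF_neg hα_int)
  by_cases htop : dZero F α = ⊤
  · rw [htop, EReal.coe_add_top, EReal.coe_mul_top_of_pos hα, EReal.exp_top,
      ENNReal.top_sub (by simp), ENNReal.top_div_of_ne_top ENNReal.ofReal_ne_top]
    exact le_top
  · obtain ⟨D, hD⟩ : ∃ D : ℝ, (D : EReal) = (d : EReal) + dZero F α := by
      generalize dZero F α = b at *
      induction b with
      | bot => simp at h0
      | top => simp at htop
      | coe b => exact ⟨d + b, by push_cast; rfl⟩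
    obtain ⟨hdD, hle⟩ := measure_lt_maxBeforeDrawdown_walk_le hX_law hX_indep hF_mean hF_neg hα
      hα_int hα_eq hd hD
    have hexp : 1 < Real.exp (α * D) := Real.one_lt_exp_iff.2 (mul_pos hα (by linarith))
    have hlam : 0 < α / (Real.exp (α * D) - 1) := div_pos hα (by linarith)
    -- Layer cake: the mean is the integral of the tail, here at most `exp (-lam * t)`.
    rw [lintegral_eq_lintegral_meas_lt P
      (Filter.Eventually.of_forall fun ω => maxBeforeDrawdown_walk_nonneg X d ω)
      (aemeasurable_maxBeforeDrawdown_walk hX_law hX_indep hF_neg d), ← hD, ← EReal.coe_mul,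
      EReal.exp_coe, ← ENNReal.ofReal_one, ← ENNReal.ofReal_sub _ zero_le_one,
      ← ENNReal.ofReal_div_of_pos hα]
    set lam := α / (Real.exp (α * D) - 1) with hlamdef
    have h1 : ∫⁻ t in Set.Ioi (0 : ℝ), P {ω | t < maxBeforeDrawdown (walk X ω) d} ≤
        ∫⁻ t in Set.Ioi (0 : ℝ), ENNReal.ofReal (Real.exp (-lam * t)) := by
      refine setLIntegral_mono' measurableSet_Ioi fun t ht => (hle t).trans ?_
      rw [expMeasure_Ioi hlam, if_pos (le_of_lt ht)]
    refine h1.trans ?_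
    rw [← ofReal_integral_eq_lintegral_ofReal (exp_neg_integrableOn_Ioi 0 hlam)
      (Filter.Eventually.of_forall fun _ => (Real.exp_pos _).le),
      integral_exp_mul_Ioi (by linarith)]
    refine ENNReal.ofReal_le_ofReal (le_of_eq ?_)
    rw [mul_zero, Real.exp_zero, neg_div_neg_eq, hlamdef, one_div_div]

end RandomWalk


/-! ### Overshoots of Gaussian variables -/

/-- Chebyshev's integral inequality for functions that vary in opposite directions on `S`. -/
lemma setIntegral_mul_le_of_antivary {ν : Measure ℝ} [IsFiniteMeasure ν] {S : Set ℝ}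
    (hS : MeasurableSet S) {g ρ : ℝ → ℝ} (hg : MonotoneOn g S) (hρ : AntitoneOn ρ S)
    (hgi : IntegrableOn g S ν) (hρi : IntegrableOn ρ S ν)
    (hgρ : IntegrableOn (fun w => g w * ρ w) S ν) :
    (∫ w in S, g w * ρ w ∂ν) * ν.real S ≤ (∫ w in S, ρ w ∂ν) * ∫ w in S, g w ∂ν := by
  set η := ν.restrict S
  -- The integrand is `(g p.1 - g p.2) * (ρ p.1 - ρ p.2)`, taken over two independent copies.
  have h1 : ∫ p, (g p.1 * ρ p.1 * 1 + 1 * (g p.2 * ρ p.2)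
      - (g p.1 * ρ p.2 + ρ p.1 * g p.2)) ∂(η.prod η) ≤ 0 := by
    refine integral_nonpos_of_ae ?_
    have : η.prod η = (ν.prod ν).restrict (S ×ˢ S) := Measure.prod_restrict S S
    rw [this]
    filter_upwards [ae_restrict_mem (hS.prod hS)] with p hp
    have h2 : (g p.1 - g p.2) * (ρ p.1 - ρ p.2) ≤ 0 := by
      rcases le_total p.1 p.2 with h | h
      · exact mul_nonpos_of_nonpos_of_nonneg (sub_nonpos.2 (hg hp.1 hp.2 h))
          (sub_nonneg.2 (hρ hp.1 hp.2 h))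
      · exact mul_nonpos_of_nonneg_of_nonpos (sub_nonneg.2 (hg hp.2 hp.1 h))
          (sub_nonpos.2 (hρ hp.2 hp.1 h))
    simp only [Pi.zero_apply]
    linarith
  have hone : Integrable (fun _ : ℝ => (1 : ℝ)) η := integrable_const _
  have i1 : Integrable (fun p : ℝ × ℝ => g p.1 * ρ p.1 * 1) (η.prod η) := hgρ.mul_prod hone
  have i2 : Integrable (fun p : ℝ × ℝ => 1 * (g p.2 * ρ p.2)) (η.prod η) := hone.mul_prod hgρ
  have i3 : Integrable (fun p : ℝ × ℝ => g p.1 * ρ p.2) (η.prod η) := hgi.mul_prod hρi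
  have i4 : Integrable (fun p : ℝ × ℝ => ρ p.1 * g p.2) (η.prod η) := hρi.mul_prod hgi
  rw [integral_sub (by exact i1.add i2) (by exact i3.add i4), integral_add i1 i2,
    integral_add i3 i4,
    integral_prod_mul (fun w => g w * ρ w) (fun _ => (1 : ℝ)),
    integral_prod_mul (fun _ => (1 : ℝ)) (fun w => g w * ρ w),
    integral_prod_mul g ρ, integral_prod_mul ρ g] at h1
  have h3 : ∫ _ : ℝ, (1 : ℝ) ∂η = ν.real S := by simp [η]
  rw [h3] at h1
  linarith

/-- The density ratio of a Gaussian law shifted by `x` with respect to itself. -/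
noncomputable def gaussianShiftRatio (m : ℝ) (v : ℝ≥0) (x w : ℝ) : ℝ :=
  Real.exp (-(x ^ 2 + 2 * x * (w - m)) / (2 * v))

lemma setIntegral_gaussianReal_shift (m : ℝ) {v : ℝ≥0} (hv : v ≠ 0) (x : ℝ) (h : ℝ → ℝ) :
    ∫ z in Set.Ioi x, h (z - x) ∂(gaussianReal m v) =
      ∫ w in Set.Ioi 0, h w * gaussianShiftRatio m v x w ∂(gaussianReal m v) := by
  rw [← integral_indicator measurableSet_Ioi, ← integral_indicator measurableSet_Ioi,
    integral_gaussianReal_eq_integral_smul hv, integral_gaussianReal_eq_integral_smul hv,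
    ← integral_add_right_eq_self _ x]
  congr 1
  ext w
  have hv' : (v : ℝ) ≠ 0 := by exact_mod_cast hv
  simp only [Set.indicator, Set.mem_Ioi, lt_add_iff_pos_left, add_sub_cancel_right, smul_eq_mul]
  split_ifs
  · have : gaussianPDFReal m v (w + x) = gaussianPDFReal m v w * gaussianShiftRatio m v x w := by
      rw [gaussianPDFReal, gaussianPDFReal, gaussianShiftRatio, mul_assoc _ (Real.exp _),
        ← Real.exp_add]
      congr 2
      field_simp
      ring
    rw [this]
    ring
  · simp

lemma integrableOn_of_le_exp {m : ℝ} {v : ℝ≥0} {g : ℝ → ℝ} {C : ℝ} (hg : Measurable g)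
    (hgb : ∀ z, 0 ≤ z → |g z| ≤ Real.exp (C * z)) :
    IntegrableOn g (Set.Ioi 0) (gaussianReal m v) := by
  refine Integrable.mono' (g := fun z => Real.exp (C * z))
    (integrable_exp_mul_gaussianReal C).integrableOn hg.aestronglyMeasurable ?_
  filter_upwards [ae_restrict_mem measurableSet_Ioi] with z hz
  exact hgb z (le_of_lt hz)

/-- The Gaussian density is log-concave: for `x ≥ 0` its shift ratio decreases, so by Chebyshev's
inequality the overshoot over `x` is stochastically largest at `x = 0`. -/
lemma gaussianReal_overshoot {m : ℝ} {v : ℝ≥0} (hv : v ≠ 0) {g : ℝ → ℝ} {C : ℝ}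
    (hgm : Monotone g) (hgb : ∀ z, 0 ≤ z → |g z| ≤ Real.exp (C * z))
    {x : ℝ} (hx : 0 ≤ x) :
    (∫ z in Set.Ioi x, g (z - x) ∂(gaussianReal m v)) * (gaussianReal m v).real (Set.Ioi 0) ≤
      (gaussianReal m v).real (Set.Ioi x) * ∫ z in Set.Ioi 0, g z ∂(gaussianReal m v) := by
  have hv' : (0 : ℝ) < v := by exact_mod_cast pos_iff_ne_zero.2 hv
  have hρm : Measurable (gaussianShiftRatio m v x) := by
    unfold gaussianShiftRatio
    fun_prop
  have hρ : Antitone (gaussianShiftRatio m v x) := by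
    intro a b hab
    unfold gaussianShiftRatio
    gcongr
  have hρb : ∀ w ∈ Set.Ioi (0 : ℝ), |gaussianShiftRatio m v x w| ≤ gaussianShiftRatio m v x 0 := by
    intro w hw
    rw [abs_of_pos (by exact Real.exp_pos _)]
    exact hρ (le_of_lt hw)
  have h1 : (gaussianReal m v).real (Set.Ioi x) =
      ∫ w in Set.Ioi 0, gaussianShiftRatio m v x w ∂(gaussianReal m v) := by
    have := setIntegral_gaussianReal_shift m hv x fun _ => 1
    simpa using this
  have hgi := integrableOn_of_le_exp (m := m) (v := v) hgm.measurable hgb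
  rw [h1, setIntegral_gaussianReal_shift m hv x g]
  refine setIntegral_mul_le_of_antivary measurableSet_Ioi (hgm.monotoneOn _) (hρ.antitoneOn _)
    hgi ?_ ?_
  · refine Integrable.of_bound hρm.aestronglyMeasurable (gaussianShiftRatio m v x 0) ?_
    filter_upwards [ae_restrict_mem measurableSet_Ioi] with w hw using hρb w hw
  · refine Integrable.mono' (hgi.norm.mul_const (gaussianShiftRatio m v x 0))
      (hgm.measurable.mul hρm).aestronglyMeasurable ?_
    filter_upwards [ae_restrict_mem measurableSet_Ioi] with w hw
    rw [norm_mul]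
    exact mul_le_mul_of_nonneg_left (hρb w hw) (norm_nonneg _)

lemma gaussianReal_real_Ioi_pos (m : ℝ) {v : ℝ≥0} (hv : v ≠ 0) (x : ℝ) :
    0 < (gaussianReal m v).real (Set.Ioi x) := by
  refine ENNReal.toReal_pos (fun h => ?_) (measure_ne_top _ _)
  have := gaussianReal_absolutelyContinuous' m hv h
  simp at this

/-- The mean of `g` over the conditional law of a Gaussian variable given that it is positive. -/
noncomputable def gaussianOvershoot (g : ℝ → ℝ) (m : ℝ) (v : ℝ≥0) : ℝ :=
  (∫ z in Set.Ioi 0, g z ∂(gaussianReal m v)) / (gaussianReal m v).real (Set.Ioi 0)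

lemma setIntegral_le_gaussianOvershoot {m : ℝ} {v : ℝ≥0} (hv : v ≠ 0) {g : ℝ → ℝ} {C : ℝ}
    (hgm : Monotone g) (hgb : ∀ z, 0 ≤ z → |g z| ≤ Real.exp (C * z))
    {x : ℝ} (hx : 0 ≤ x) :
    ∫ z in Set.Ioi x, g (z - x) ∂(gaussianReal m v) ≤
      gaussianOvershoot g m v * (gaussianReal m v).real (Set.Ioi x) := by
  rw [gaussianOvershoot, div_mul_eq_mul_div, le_div_iff₀ (gaussianReal_real_Ioi_pos m hv 0)]
  refine (gaussianReal_overshoot hv hgm hgb hx).trans_eq (mul_comm _ _)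

lemma gaussianReal_eq_map_standard (m : ℝ) (v : ℝ≥0) :
    gaussianReal m v = (gaussianReal 0 1).map fun n => √v * n + m := by
  have h : (fun n : ℝ => √(v : ℝ) * n + m) = (fun y => y + m) ∘ fun n => √(v : ℝ) * n := rfl
  rw [h, ← Measure.map_map (by fun_prop) (by fun_prop), gaussianReal_map_const_mul,
    gaussianReal_map_add_const]
  congr 1
  · simp
  · ext
    simp

/-- The numerator tends to `0` by dominated convergence after standardizing. The denominator stays
away from `0` because the mean is at most one standard deviation in absolute value. -/
lemma tendsto_gaussianOvershoot {g : ℝ → ℝ} {C : ℝ} (hC : 0 ≤ C)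
    (hgm : Monotone g) (hgc : Continuous g) (hg0 : g 0 = 0)
    (hgb : ∀ z, 0 ≤ z → |g z| ≤ Real.exp (C * z)) {m : ℕ → ℝ} {v : ℕ → ℝ≥0}
    (hv0 : ∀ k, v k ≠ 0) (hm : Filter.Tendsto m Filter.atTop (nhds 0))
    (hv : Filter.Tendsto (fun k => (v k : ℝ)) Filter.atTop (nhds 0))
    (hmv : ∀ᶠ k in Filter.atTop, |m k| ≤ √(v k)) :
    Filter.Tendsto (fun k => gaussianOvershoot g (m k) (v k)) Filter.atTop (nhds 0) := by
  have hsq : Filter.Tendsto (fun k => √(v k : ℝ)) Filter.atTop (nhds 0) := by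
    have := (Real.continuous_sqrt.tendsto 0).comp hv
    rwa [Real.sqrt_zero] at this
  have hnum : Filter.Tendsto (fun k => ∫ z in Set.Ioi 0, g z ∂(gaussianReal (m k) (v k)))
      Filter.atTop (nhds 0) := by
    have hind : Measurable ((Set.Ioi (0 : ℝ)).indicator g) :=
      hgc.measurable.indicator measurableSet_Ioi
    have e : ∀ k, ∫ z in Set.Ioi 0, g z ∂(gaussianReal (m k) (v k)) =
        ∫ n, (Set.Ioi (0 : ℝ)).indicator g (√(v k) * n + m k) ∂(gaussianReal 0 1) := fun k => by
      rw [← integral_indicator measurableSet_Ioi, gaussianReal_eq_map_standard,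
        integral_map (by fun_prop) hind.aestronglyMeasurable]
    simp_rw [e]
    suffices h : Filter.Tendsto (fun k => ∫ n, (Set.Ioi (0 : ℝ)).indicator g (√(v k) * n + m k)
        ∂(gaussianReal 0 1)) Filter.atTop (nhds (∫ _ : ℝ, (0 : ℝ) ∂(gaussianReal 0 1))) by
      simpa using h
    refine tendsto_integral_filter_of_dominated_convergence
      (fun n => Real.exp C * Real.exp (C * |n|))
      (Filter.Eventually.of_forall fun k => (hind.comp (by fun_prop :
        Measurable fun n : ℝ => √(v k) * n + m k)).aestronglyMeasurable)
      ?_ ((integrable_exp_mul_abs (integrable_exp_mul_gaussianReal C)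
        (integrable_exp_mul_gaussianReal (-C))).const_mul _)
      (Filter.Eventually.of_forall fun n => ?_)
    · filter_upwards [hsq.eventually_le_const zero_lt_one,
        hm.eventually_le_const zero_lt_one] with k hk1 hk2
      refine Filter.Eventually.of_forall fun n => ?_
      simp only [Set.indicator, Set.mem_Ioi]
      split_ifs with h
      · refine (hgb _ h.le).trans ?_
        rw [← Real.exp_add]
        refine Real.exp_le_exp.2 ?_
        have h3 : √(v k : ℝ) * n ≤ |n| := by
          refine (mul_le_mul_of_nonneg_left (le_abs_self n) (Real.sqrt_nonneg _)).trans ?_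
          exact mul_le_of_le_one_left (abs_nonneg n) hk1
        nlinarith
      · rw [norm_zero]
        positivity
    · have hlim : Filter.Tendsto (fun k => √(v k : ℝ) * n + m k) Filter.atTop (nhds 0) := by
        simpa using (hsq.mul_const n).add hm
      have hlim2 : Filter.Tendsto (fun k => g (√(v k : ℝ) * n + m k)) Filter.atTop (nhds 0) := by
        have := (hgc.tendsto 0).comp hlim
        rwa [hg0] at this
      refine squeeze_zero_norm (fun k => ?_) (by simpa using hlim2.norm)
      exact norm_indicator_le_norm_self _ _
  set p := (gaussianReal 0 1).real (Set.Ioi 1)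
  have hp : 0 < p := gaussianReal_real_Ioi_pos 0 one_ne_zero 1
  have hnum0 : ∀ k, 0 ≤ ∫ z in Set.Ioi 0, g z ∂(gaussianReal (m k) (v k)) := fun k =>
    setIntegral_nonneg measurableSet_Ioi fun z hz => hg0 ▸ hgm (le_of_lt hz)
  refine squeeze_zero' (Filter.Eventually.of_forall fun k => ?_) ?_
    (by simpa using hnum.div_const p)
  · exact div_nonneg (hnum0 k) (gaussianReal_real_Ioi_pos _ (hv0 k) 0).le
  · filter_upwards [hmv] with k hk
    refine div_le_div_of_nonneg_left (hnum0 k) hp ?_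
    refine ENNReal.toReal_mono (measure_ne_top _ _) ?_
    rw [gaussianReal_eq_map_standard (m k), Measure.map_apply (by fun_prop) measurableSet_Ioi]
    -- A standard normal value above `1` makes `√v * n + m` positive as soon as `|m| ≤ √v`.
    refine measure_mono fun n hn => ?_
    have hn' : 1 < n := hn
    have hv' : (0 : ℝ) < √(v k) := Real.sqrt_pos.2 (by exact_mod_cast pos_iff_ne_zero.2 (hv0 k))
    have := neg_abs_le (m k)
    simp only [Set.mem_preimage, Set.mem_Ioi]
    nlinarith


/-! ### Continuous paths and their grid samples -/

section Paths

variable {f : ℝ≥0 → ℝ}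

lemma bddAbove_image_Iic_of_continuous (hf : Continuous f) (t : ℝ≥0) :
    BddAbove (f '' Set.Iic t) := by
  rw [← Set.Icc_bot]
  exact (isCompact_Icc.image hf).bddAbove

lemma mem_drawdownSet_of_continuous (hf : Continuous f) {d : ℝ} {t : ℝ≥0} :
    t ∈ drawdownSet f d ↔ ∃ r ≤ t, f t + d ≤ f r := by
  constructor
  · intro h
    have hc : IsCompact (Set.Iic t) := by
      rw [← Set.Icc_bot]
      exact isCompact_Icc
    obtain ⟨r, hr, hr'⟩ := hc.exists_sSup_image_eq ⟨t, Set.mem_Iic.2 le_rfl⟩ hf.continuousOn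
    exact ⟨r, hr, hr' ▸ h⟩
  · rintro ⟨r, hr, h⟩
    exact h.trans (le_csSup (bddAbove_image_Iic_of_continuous hf t) ⟨r, hr, rfl⟩)

/-- Writing the earlier time as `u * t` with `u` in the unit interval shows the set as a projection
of a closed set along a compact factor. Hence the first drawdown time is attained. -/
lemma isClosed_drawdownSet (hf : Continuous f) (d : ℝ) : IsClosed (drawdownSet f d) := by
  have h : drawdownSet f d =
      Prod.snd '' {p : unitInterval × ℝ≥0 | f p.2 + d ≤ f (unitInterval.toNNReal p.1 * p.2)} := by
    ext t
    rw [mem_drawdownSet_of_continuous hf]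
    constructor
    · rintro ⟨r, hr, h⟩
      rcases eq_or_ne t 0 with rfl | ht
      · exact ⟨(0, 0), by simpa [nonpos_iff_eq_zero.1 hr] using h, rfl⟩
      · refine ⟨(⟨(r / t : ℝ≥0), NNReal.coe_nonneg _, ?_⟩, t), ?_, rfl⟩
        · exact_mod_cast div_le_one_of_le₀ hr zero_le
        · have : unitInterval.toNNReal ⟨(r / t : ℝ≥0), NNReal.coe_nonneg _, by
              exact_mod_cast div_le_one_of_le₀ hr zero_le⟩ * t = r := by
            ext
            simp [ht]
          simp only [Set.mem_ofPred_eq, this]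
          exact h
    · rintro ⟨⟨u, t'⟩, h, rfl⟩
      exact ⟨_, mul_le_of_le_one_left zero_le (by exact_mod_cast u.2.2), h⟩
  rw [h]
  refine isClosedMap_snd_of_compactSpace _ (isClosed_le (by fun_prop) ?_)
  exact hf.comp ((unitInterval.toNNReal_continuous.comp continuous_fst).mul continuous_snd)

lemma floor_mul_le {δ t : ℝ≥0} (hδ : 0 < δ) : (⌊t / δ⌋₊ : ℝ≥0) * δ ≤ t := by
  have := Nat.floor_le (a := t / δ) zero_le
  rwa [le_div_iff₀ hδ] at this

lemma tendsto_floor_mul {δ : ℕ → ℝ≥0} (hδ : ∀ k, 0 < δ k)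
    (hδ0 : Filter.Tendsto δ Filter.atTop (nhds 0)) (t : ℝ≥0) :
    Filter.Tendsto (fun k => (⌊t / δ k⌋₊ : ℝ≥0) * δ k) Filter.atTop (nhds t) := by
  have h1 : Filter.Tendsto (fun k => t - δ k) Filter.atTop (nhds t) := by
    simpa using (tendsto_const_nhds (x := t)).sub hδ0
  refine tendsto_of_tendsto_of_tendsto_of_le_of_le h1 tendsto_const_nhds (fun k => ?_) fun k => ?_
  · have := (Nat.lt_floor_add_one (t / δ k)).le
    rw [div_le_iff₀ (hδ k), add_mul, one_mul] at this
    exact tsub_le_iff_right.2 this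
  · exact floor_mul_le (hδ k)

/-- A grid drawdown is a drawdown of the path, and rounding the exceedance time down keeps it early
enough; continuity keeps the value above `x`. -/
lemma Exceeds.eventually_grid (hf : Continuous f) {δ : ℕ → ℝ≥0} (hδ : ∀ k, 0 < δ k)
    (hδ0 : Filter.Tendsto δ Filter.atTop (nhds 0)) {d x : ℝ} (h : Exceeds f d x) :
    ∀ᶠ k in Filter.atTop, Exceeds (fun n : ℕ => f (n * δ k)) d x := by
  obtain ⟨t, ht, hs⟩ := h
  have h1 := ((hf.tendsto t).comp (tendsto_floor_mul hδ hδ0 t)).eventually_const_lt ht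
  filter_upwards [h1] with k hk
  refine ⟨⌊t / δ k⌋₊, hk, fun j hj => ?_⟩
  obtain ⟨i, hi, hij⟩ := mem_drawdownSet_nat.1 hj
  have h2 : t ≤ j * δ k := hs _ ((mem_drawdownSet_of_continuous hf).2
    ⟨i * δ k, mul_le_mul_left (by exact_mod_cast hi) _, hij⟩)
  have h3 := (floor_mul_le (hδ k)).trans h2
  exact_mod_cast le_of_mul_le_mul_right h3 (hδ k)

/-- The slack `d' < d` absorbs the rounding: a path drawdown `d` at time `s` forces, on fine grids,
a drawdown `d'` at the grid point just below `s`, so a grid exceedance cannot come after `s`. -/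
lemma exceeds_of_frequently_grid (hf : Continuous f) {δ : ℕ → ℝ≥0} (hδ : ∀ k, 0 < δ k)
    (hδ0 : Filter.Tendsto δ Filter.atTop (nhds 0)) {d d' x : ℝ} (hd : d' < d)
    (hne : (drawdownSet f d).Nonempty)
    (h : ∃ᶠ k in Filter.atTop, Exceeds (fun n : ℕ => f (n * δ k)) d' x) : Exceeds f d x := by
  by_contra hcon
  simp only [Exceeds, not_exists, not_and, not_forall, not_le] at hcon
  have hmem := (isClosed_drawdownSet hf d).csInf_mem hne (OrderBot.bddBelow _)
  set s := sInf (drawdownSet f d)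
  obtain ⟨r, hr, hrs⟩ := (mem_drawdownSet_of_continuous hf).1 hmem
  have h1 := ((hf.tendsto s).comp (tendsto_floor_mul hδ hδ0 s)).add_const d'
  have h2 := (hf.tendsto r).comp (tendsto_floor_mul hδ hδ0 r)
  obtain ⟨k, ⟨n, hn, hj⟩, hk⟩ := (h.and_eventually (h1.eventually_lt h2 (by linarith))).exists
  obtain ⟨q, hq, hqn⟩ := hcon _ hn
  have h3 := hj ⌊s / δ k⌋₊ (mem_drawdownSet_nat.2 ⟨⌊r / δ k⌋₊,
    Nat.floor_mono (by gcongr), hk.le⟩)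
  have h4 : s ≤ q := csInf_le (OrderBot.bddBelow _) hq
  have h5 : (⌊s / δ k⌋₊ : ℝ≥0) * δ k < n * δ k := ((floor_mul_le (hδ k)).trans h4).trans_lt hqn
  have h6 : ((⌊s / δ k⌋₊ : ℕ) : ℝ≥0) < n := lt_of_mul_lt_mul_right h5 zero_le
  exact absurd h3 (not_le.2 (by exact_mod_cast h6))

end Paths

/-! ### Gaussian walks with vanishing steps -/

lemma gaussianReal_real_Iio_pos (m : ℝ) {v : ℝ≥0} (hv : v ≠ 0) (x : ℝ) :
    0 < gaussianReal m v (Set.Iio x) := by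
  refine pos_iff_ne_zero.2 fun h => ?_
  have := gaussianReal_absolutelyContinuous' m hv h
  simp at this

section GaussianWalk

variable {Ω : Type*} [MeasurableSpace Ω] {P : Measure Ω} [IsProbabilityMeasure P]

lemma setIntegral_const_add_of_gaussianOvershoot {m : ℝ} {v : ℝ≥0} (hv : v ≠ 0) {a x : ℝ}
    (ha : 0 ≤ a) (hx : 0 ≤ x) :
    ∫ z in Set.Ioi x, (Real.exp (a * (z - x)) -
      (1 + gaussianOvershoot (fun z => Real.exp (a * z) - 1) m v)) ∂(gaussianReal m v) ≤ 0 := by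
  have hint : Integrable (fun z => Real.exp (a * (z - x)) - 1) (gaussianReal m v) := by
    have : (fun z => Real.exp (a * (z - x)) - 1) =
        fun z => Real.exp (-a * x) * Real.exp (a * z) - 1 := by
      ext z; rw [← Real.exp_add]; ring_nf
    rw [this]
    exact ((integrable_exp_mul_gaussianReal a).const_mul _).sub (integrable_const _)
  have h := setIntegral_le_gaussianOvershoot (m := m) hv (g := fun z => Real.exp (a * z) - 1)
    (C := a) (fun y z hyz => by
      have := mul_le_mul_of_nonneg_left hyz ha
      simpa using this) (fun z hz => by
      have := Real.one_le_exp (mul_nonneg ha hz)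
      rw [abs_of_nonneg (by linarith)]
      linarith) hx
  simp_rw [← sub_sub]
  rw [integral_sub hint.integrableOn (integrable_const _)]
  simp only [integral_const, measureReal_restrict_apply_univ, smul_eq_mul]
  linarith

lemma setIntegral_exp_neg_of_gaussianOvershoot {m : ℝ} {v : ℝ≥0} (hv : v ≠ 0) {a x : ℝ}
    (ha : 0 ≤ a) (hx : 0 ≤ x) :
    0 ≤ ∫ z in Set.Ioi x, (Real.exp (-a * (z - x)) -
      (1 - gaussianOvershoot (fun z => 1 - Real.exp (-a * z)) m v)) ∂(gaussianReal m v) := by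
  have hint : Integrable (fun z => 1 - Real.exp (-a * (z - x))) (gaussianReal m v) := by
    have : (fun z => 1 - Real.exp (-a * (z - x))) =
        fun z => 1 - Real.exp (a * x) * Real.exp (-a * z) := by
      ext z; rw [← Real.exp_add]; ring_nf
    rw [this]
    exact (integrable_const _).sub ((integrable_exp_mul_gaussianReal (-a)).const_mul _)
  have h := setIntegral_le_gaussianOvershoot (m := m) hv (g := fun z => 1 - Real.exp (-a * z))
    (C := 0) (fun y z hyz => sub_le_sub_left
      (Real.exp_le_exp.2 (by
        have := mul_le_mul_of_nonneg_left hyz ha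
        linarith)) 1) (fun z hz => by
      have : Real.exp (-a * z) ≤ 1 := Real.exp_le_one_iff.2 (by nlinarith)
      have := Real.exp_pos (-a * z)
      rw [abs_of_nonneg (by linarith), zero_mul, Real.exp_zero]
      linarith) hx
  have e : ∀ z, Real.exp (-a * (z - x)) -
      (1 - gaussianOvershoot (fun z => 1 - Real.exp (-a * z)) m v) =
      gaussianOvershoot (fun z => 1 - Real.exp (-a * z)) m v - (1 - Real.exp (-a * (z - x))) :=
    fun z => by ring
  simp_rw [e]
  rw [integral_sub (integrable_const _) hint.integrableOn]
  simp only [integral_const, measureReal_restrict_apply_univ, smul_eq_mul]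
  linarith

/-- Reflection turns the undershoot into an overshoot for the mean `-m`. -/
lemma setIntegral_Iic_of_gaussianOvershoot {m : ℝ} {v : ℝ≥0} (hv : v ≠ 0) {a x : ℝ}
    (ha : 0 ≤ a) (hx : x < 0) :
    ∫ z in Set.Iic x, (Real.exp (a * (x - z)) -
      (1 + gaussianOvershoot (fun z => Real.exp (a * z) - 1) (-m) v)) ∂(gaussianReal m v) ≤ 0 := by
  have h := setIntegral_const_add_of_gaussianOvershoot (m := -m) hv ha
    (neg_nonneg.2 hx.le)
  have := nullSingletonClass_gaussianReal (μ := m) hv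
  rw [← gaussianReal_map_neg (μ := m),
    setIntegral_map measurableSet_Ioi (by fun_prop) (by fun_prop)] at h
  have hset : (fun z : ℝ => -z) ⁻¹' Set.Ioi (-x) = Set.Iio x := by
    ext z
    simp
  rw [hset, setIntegral_congr_set Iio_ae_eq_Iic] at h
  convert h using 5
  ring_nf

/-- For Gaussian random walks with fixed adjustment coefficient `α` and vanishing steps, the
probability of exceeding the level `x` before a drawdown `d` converges. -/
lemma tendsto_measure_exceeds_gaussian {α μ : ℝ} (hα : 0 < α) {q : ℝ≥0}
    (hq : q ≠ 0) (hαq : 2 * μ / q = α) {δ : ℕ → ℝ≥0} (hδ : ∀ k, 0 < δ k)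
    (hδ0 : Filter.Tendsto δ Filter.atTop (nhds 0)) {X : ℕ → ℕ → Ω → ℝ}
    (hX_law : ∀ k i, HasLaw (X k i) (gaussianReal (μ * δ k) (q * δ k)) P)
    (hX_indep : ∀ k, iIndepFun (X k) P) {d x : ℝ} (hd : 0 < d) (hx : 0 ≤ x) :
    Filter.Tendsto (fun k => P {ω | Exceeds (walk (X k) ω) d x}) Filter.atTop
      (nhds (ENNReal.ofReal (Real.exp (-(α / (Real.exp (α * d) - 1)) * x)))) := by
  have hv : ∀ k, q * δ k ≠ 0 := fun k => mul_ne_zero hq (hδ k).ne'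
  have hα_int : ∀ k, Integrable (fun y : ℝ => Real.exp (-α * y))
      (gaussianReal (μ * δ k) (q * δ k)) := fun k => integrable_exp_mul_gaussianReal _
  have hα_eq : ∀ k, ∫ y, Real.exp (-α * y) ∂(gaussianReal (μ * δ k) (q * δ k)) = 1 := by
    intro k
    -- The adjustment coefficient is twice the mean over the variance, so the mesh cancels.
    have h1 : mgf id (gaussianReal (μ * δ k) (q * δ k)) (-α) = 1 := by
      rw [mgf_id_gaussianReal]
      simp only
      rw [Real.exp_eq_one_iff]
      have hq' : (q : ℝ) ≠ 0 := by exact_mod_cast hq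
      rw [← hαq]
      push_cast
      field_simp
      ring
    exact h1
  have hexp : 1 < Real.exp (α * d) := Real.one_lt_exp_iff.2 (by positivity)
  set A := Real.exp (α * d) with hA
  set lam := α / (A - 1) with hlam
  have hA1 : 0 < A - 1 := by linarith
  have hlam0 : 0 < lam := div_pos hα hA1
  have hδr : Filter.Tendsto (fun k => (δ k : ℝ)) Filter.atTop (nhds 0) := 
    NNReal.tendsto_coe.2 hδ0
  have hm0 : Filter.Tendsto (fun k => μ * (δ k : ℝ)) Filter.atTop (nhds 0) := by
    simpa using hδr.const_mul μ
  have hv0 : Filter.Tendsto (fun k => ((q * δ k : ℝ≥0) : ℝ)) Filter.atTop (nhds 0) := by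
    simpa using hδr.const_mul (q : ℝ)
  -- The mean is of order `δ` and the standard deviation of order `√δ`.
  have hmv : ∀ᶠ k in Filter.atTop, |μ * (δ k : ℝ)| ≤ √((q * δ k : ℝ≥0) : ℝ) := by
    have hlt : Filter.Tendsto (fun k => μ ^ 2 * (δ k : ℝ)) Filter.atTop (nhds 0) := by
      simpa using hδr.const_mul (μ ^ 2)
    have hq' : (0 : ℝ) < q := by exact_mod_cast pos_iff_ne_zero.2 hq
    filter_upwards [hlt.eventually_le_const hq'] with k hk
    refine Real.abs_le_sqrt ?_
    have := mul_le_mul_of_nonneg_right hk (δ k).2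
    push_cast
    refine le_trans (le_of_eq ?_) this
    simp only [NNReal.val_eq_coe]
    ring
  have hexpg : ∀ a : ℝ, 0 ≤ a → ∀ m : ℕ → ℝ, Filter.Tendsto m Filter.atTop (nhds 0) →
      (∀ᶠ k in Filter.atTop, |m k| ≤ √((q * δ k : ℝ≥0) : ℝ)) →
      Filter.Tendsto (fun k => gaussianOvershoot (fun z => Real.exp (a * z) - 1) (m k) (q * δ k))
        Filter.atTop (nhds 0) := fun a ha m h1 h2 =>
    tendsto_gaussianOvershoot (C := a) ha (fun y z hyz => by
      have := mul_le_mul_of_nonneg_left hyz ha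
      simpa using this) (by fun_prop) (by simp) (fun z hz => by
      have := Real.one_le_exp (mul_nonneg ha hz)
      rw [abs_of_nonneg (by linarith)]
      linarith) hv h1 hv0 h2
  have hup := tendsto_gaussianOvershoot (C := 0) le_rfl (g := fun z => 1 - Real.exp (-α * z))
    (fun y z hyz => sub_le_sub_left
      (Real.exp_le_exp.2 (by
        have := mul_le_mul_of_nonneg_left hyz hα.le
        linarith)) 1) (by fun_prop) (by simp) (fun z hz => by
      have : Real.exp (-α * z) ≤ 1 := Real.exp_le_one_iff.2 (by nlinarith)
      have := Real.exp_pos (-α * z)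
      rw [abs_of_nonneg (by linarith), zero_mul, Real.exp_zero]
      linarith) hv hm0 hv0 hmv
  have hlow := hexpg lam hlam0.le _ hm0 hmv
  have hdown := hexpg α hα.le (fun k => -(μ * (δ k : ℝ))) (by simpa using hm0.neg)
    (by simpa using hmv)
  set ε1 := fun k => gaussianOvershoot (fun z => 1 - Real.exp (-α * z)) (μ * δ k) (q * δ k)
    with hε1
  set ε2 := fun k => gaussianOvershoot (fun z => Real.exp (lam * z) - 1) (μ * δ k) (q * δ k)
    with hε2
  set ε3 := fun k => gaussianOvershoot (fun z => Real.exp (α * z) - 1) (-(μ * δ k)) (q * δ k)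
    with hε3
  have hε_nonneg : ∀ a : ℝ, 0 ≤ a → ∀ (m : ℝ) (v : ℝ≥0),
      0 ≤ gaussianOvershoot (fun z => Real.exp (a * z) - 1) m v := fun a ha m v =>
    div_nonneg (setIntegral_nonneg measurableSet_Ioi fun z hz => by
      have := Real.one_le_exp (mul_nonneg ha (le_of_lt hz))
      linarith) ENNReal.toReal_nonneg
  -- The rate solves `c (lam + α) = A lam` with `c = 1 - ε1 k` and `A` equal to `(1 + ε3 k) * exp (α
  -- * d)`.
  have hlamk : Filter.Tendsto (fun k => α * (1 - ε1 k) / ((1 + ε3 k) * A - (1 - ε1 k)))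
      Filter.atTop (nhds lam) := by
    have h1 := (hup.const_sub 1).const_mul α
    have h2 := ((hdown.const_add 1).mul_const A).sub (hup.const_sub 1)
    have h3 := h1.div h2 (by simpa using hA1.ne')
    simp only [sub_zero, mul_one, add_zero, one_mul] at h3
    exact h3
  have hupper : Filter.Tendsto (fun k => ENNReal.ofReal (Real.exp
      (-(α * (1 - ε1 k) / ((1 + ε3 k) * A - (1 - ε1 k))) * x))) Filter.atTop
      (nhds (ENNReal.ofReal (Real.exp (-lam * x)))) :=
    ENNReal.tendsto_ofReal ((Real.continuous_exp.tendsto _).comp (hlamk.neg.mul_const x))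
  have hlower : Filter.Tendsto (fun k => ENNReal.ofReal (Real.exp (-lam * x) / (1 + ε2 k)))
      Filter.atTop (nhds (ENNReal.ofReal (Real.exp (-lam * x)))) := by
    refine ENNReal.tendsto_ofReal ?_
    have := (tendsto_const_nhds (x := Real.exp (-lam * x))).div (hlow.const_add 1) (by simp)
    simp only [add_zero, div_one] at this
    exact this
  choose X' hX'm hX'l hX'i hX'e using fun k => exists_measurable_version (hX_law k) (hX_indep k)
  have hPeq : ∀ k, P {ω | Exceeds (walk (X k) ω) d x} =
      P {ω | Exceeds (partialSum fun i => X' k i ω) d x} := fun k => by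
    refine measure_congr ?_
    filter_upwards [hX'e k] with ω hω
    exact congrArg (fun f => Exceeds f d x) hω
  simp_rw [hPeq]
  refine tendsto_of_tendsto_of_tendsto_of_le_of_le' hlower hupper ?_ ?_
  · refine Filter.Eventually.of_forall fun k => ?_
    refine le_measure_exceeds (hX'm k) (hX'l k) (hX'i k)
      (ae_nonempty_drawdownSet (hX'm k) (hX'l k) (hX'i k) (gaussianReal_real_Iio_pos _ (hv k) 0))
      hα (div_mul_cancel₀ α hA1.ne') hd hA (hα_int k) (hα_eq k)
      (integrable_exp_mul_gaussianReal _) ?_ (fun y hy => ?_) hx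
    · have := hε_nonneg lam hlam0.le (μ * δ k) (q * δ k)
      simp only [hε2]
      linarith
    · have := setIntegral_const_add_of_gaussianOvershoot (m := μ * δ k) (hv k) hlam0.le hy
      rw [← neg_nonneg, ← integral_neg] at this
      simpa only [neg_sub] using this
  · filter_upwards [hup.eventually_lt_const zero_lt_one] with k hk
    have hε3 : 0 ≤ ε3 k := hε_nonneg α hα.le _ _
    have hε1n : 0 ≤ ε1 k := div_nonneg (setIntegral_nonneg measurableSet_Ioi fun z hz => by
      have hz' : (0 : ℝ) < z := hz
      have : Real.exp (-α * z) ≤ 1 := Real.exp_le_one_iff.2 (by nlinarith)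
      linarith) ENNReal.toReal_nonneg
    have hc : 0 < 1 - ε1 k := by
      simp only [hε1]
      linarith
    have hden : 0 < (1 + ε3 k) * A - (1 - ε1 k) := by nlinarith
    refine measure_exceeds_le (c := 1 - ε1 k) (κ := 1 + ε3 k) (A := (1 + ε3 k) * A)
      (hX'm k) (hX'l k) (hX'i k) hα
      (div_pos (mul_pos hα hc) hden) ?_ hd rfl (by linarith) (hα_int k) (hα_eq k)
      (fun y hy => setIntegral_exp_neg_of_gaussianOvershoot (hv k) hα.le hy)
      (fun y hy => setIntegral_Iic_of_gaussianOvershoot (hv k) hα.le hy) hx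
    field_simp
    ring

end GaussianWalk


/-! ### Probabilities of lower and upper limits of events -/

section SetLimits

variable {Ω : Type*} [MeasurableSpace Ω] {P : Measure Ω}

lemma measure_eventually_mem_le {E : ℕ → Set Ω} {l : ℝ≥0∞}
    (h : Filter.Tendsto (fun k => P (E k)) Filter.atTop (nhds l)) :
    P {ω | ∀ᶠ k in Filter.atTop, ω ∈ E k} ≤ l := by
  have hU : {ω | ∀ᶠ k in Filter.atTop, ω ∈ E k} = ⋃ N : ℕ, ⋂ k ≥ N, E k := by
    ext ω
    simp [Filter.eventually_atTop]
  have hmono : Monotone fun N : ℕ => ⋂ k ≥ N, E k := fun N M hNM =>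
    Set.biInter_subset_biInter_left fun k hk => hNM.trans hk
  rw [hU]
  refine le_of_tendsto' (tendsto_measure_iUnion_atTop hmono) fun N => ?_
  refine ge_of_tendsto h ?_
  filter_upwards [Filter.eventually_ge_atTop N] with k hk
  exact measure_mono (Set.biInter_subset_of_mem hk)

lemma setOf_frequently_mem_eq {Ω : Type*} (E : ℕ → Set Ω) :
    {ω | ∃ᶠ k in Filter.atTop, ω ∈ E k} = ⋂ N : ℕ, ⋃ k ≥ N, E k := by
  ext ω
  simp [Filter.frequently_atTop]

lemma nullMeasurableSet_frequently_mem {E : ℕ → Set Ω} (hE : ∀ k, NullMeasurableSet (E k) P) :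
    NullMeasurableSet {ω | ∃ᶠ k in Filter.atTop, ω ∈ E k} P := by
  rw [setOf_frequently_mem_eq]
  exact NullMeasurableSet.iInter fun N =>
    NullMeasurableSet.iUnion fun k => NullMeasurableSet.iUnion fun _ => hE k

lemma le_measure_frequently_mem [IsFiniteMeasure P] {E : ℕ → Set Ω}
    (hE : ∀ k, NullMeasurableSet (E k) P) {l : ℝ≥0∞}
    (h : Filter.Tendsto (fun k => P (E k)) Filter.atTop (nhds l)) :
    l ≤ P {ω | ∃ᶠ k in Filter.atTop, ω ∈ E k} := by
  rw [setOf_frequently_mem_eq]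
  have hanti : Antitone fun N : ℕ => ⋃ k ≥ N, E k := fun N M hNM =>
    Set.biUnion_subset_biUnion_left fun k hk => hNM.trans hk
  refine ge_of_tendsto' (tendsto_measure_iInter_atTop (fun N =>
    NullMeasurableSet.iUnion fun k => NullMeasurableSet.iUnion fun _ => hE k) hanti
    ⟨0, measure_ne_top _ _⟩) fun N => ?_
  refine le_of_tendsto h ?_
  filter_upwards [Filter.eventually_ge_atTop N] with k hk
  exact measure_mono (Set.subset_biUnion_of_mem (u := E) hk)

end SetLimits

/-! ### The maximum of a drifted Brownian motion before a drawdown -/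

section Brownian

variable {Ω : Type*} {W : ℝ≥0 → Ω → ℝ} {μ σ : ℝ}

/-- The increments of the drifted Brownian path over the grid of mesh `δ`. -/
noncomputable def gridIncrement (W : ℝ≥0 → Ω → ℝ) (μ σ : ℝ) (δ : ℝ≥0) (i : ℕ) (ω : Ω) : ℝ :=
  driftedPath W μ σ ω ((i + 1 : ℕ) * δ) - driftedPath W μ σ ω (i * δ)

lemma gridIncrement_eq (W : ℝ≥0 → Ω → ℝ) (μ σ : ℝ) (δ : ℝ≥0) (i : ℕ) (ω : Ω) :
    gridIncrement W μ σ δ i ω = μ * δ + σ * (W ((i + 1 : ℕ) * δ) ω - W (i * δ) ω) := by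
  unfold gridIncrement driftedPath
  push_cast
  ring

lemma walk_gridIncrement {ω : Ω} (h0 : W 0 ω = 0) (δ : ℝ≥0) :
    walk (gridIncrement W μ σ δ) ω = fun n : ℕ => driftedPath W μ σ ω (n * δ) := by
  ext n
  have h := Finset.sum_range_sub (fun i : ℕ => driftedPath W μ σ ω (i * δ)) n
  simp only [Nat.cast_zero, zero_mul] at h
  have h0' : driftedPath W μ σ ω 0 = 0 := by simp [driftedPath, h0]
  rw [h0', sub_zero] at h
  exact h

lemma continuous_driftedPath {ω : Ω} (h : Continuous (W · ω)) :
    Continuous (driftedPath W μ σ ω) := by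
  unfold driftedPath
  fun_prop

variable [MeasurableSpace Ω] {P : Measure Ω}

lemma hasLaw_gridIncrement (hW : IsBrownianReal W P) (δ : ℝ≥0) (i : ℕ) :
    HasLaw (gridIncrement W μ σ δ i) (gaussianReal (μ * δ) (NNReal.mk (σ ^ 2) (sq_nonneg σ) * δ)) P := by
  have h := gaussianReal_const_add
    (gaussianReal_const_mul (hW.hasLaw_sub ((i + 1 : ℕ) * δ) (i * δ)) σ) (μ * δ)
  have hn : nndist (((i + 1 : ℕ) * δ : ℝ≥0) : ℝ) ((i * δ : ℝ≥0) : ℝ) = δ := by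
    ext
    rw [coe_nndist, Real.dist_eq]
    push_cast
    have : ((i : ℝ) + 1) * δ - i * δ = δ := by ring
    rw [this, NNReal.abs_eq]
  have he : gridIncrement W μ σ δ i =
      fun ω => μ * δ + σ * (W ((i + 1 : ℕ) * δ) - W (i * δ)) ω := by
    ext ω
    exact gridIncrement_eq W μ σ δ i ω
  rw [he]
  convert h using 2
  · simp
  · rw [show nndist (((i + 1 : ℕ) * δ : ℝ≥0).1) ((i * δ : ℝ≥0).1) = δ from hn]

lemma iIndepFun_gridIncrement (hW : IsBrownianReal W P) (δ : ℝ≥0) :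
    iIndepFun (gridIncrement W μ σ δ) P := by
  have hmono : Monotone fun i : ℕ => (i : ℝ≥0) * δ := fun i j hij => by
    simp only
    gcongr
  have h := (hW.hasIndepIncrements.nat hmono).comp (fun _ y => μ * δ + σ * y)
    fun _ => by fun_prop
  convert h using 1
  ext i ω
  exact gridIncrement_eq W μ σ δ i ω

/-- The walk on the grid of mesh `1` already achieves every drawdown, and its drawdowns are
drawdowns of the path. -/
lemma ae_good_driftedPath (hσ : 0 < σ) (hW : IsBrownianReal W P) :
    ∀ᵐ ω ∂P, Continuous (driftedPath W μ σ ω) ∧ W 0 ω = 0 ∧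
      ∀ d, (drawdownSet (driftedPath W μ σ ω) d).Nonempty := by
  have hv : NNReal.mk (σ ^ 2) (sq_nonneg σ) * 1 ≠ 0 := by
    rw [mul_one]
    exact fun h => (pow_pos hσ 2).ne' (congrArg NNReal.toReal h)
  obtain ⟨X', h1, h2, h3, h4⟩ := exists_measurable_version
    (hasLaw_gridIncrement (μ := μ) (σ := σ) hW 1) (iIndepFun_gridIncrement hW 1)
  filter_upwards [hW.cont, hW.eval_zero_ae_eq_zero, h4,
    ae_nonempty_drawdownSet h1 h2 h3 (gaussianReal_real_Iio_pos _ hv 0)] with ω c1 c2 c3 c4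
  have hc := continuous_driftedPath (μ := μ) (σ := σ) c1
  refine ⟨hc, c2, fun d => ?_⟩
  rw [← c3, walk_gridIncrement c2] at c4
  obtain ⟨n, hn⟩ := c4 d
  obtain ⟨i, hi, h⟩ := mem_drawdownSet_nat.1 hn
  exact ⟨n * 1, (mem_drawdownSet_of_continuous hc).2
    ⟨i * 1, mul_le_mul_left (by exact_mod_cast hi) _, h⟩⟩

lemma nullMeasurableSet_exceeds_walk {F : Measure ℝ} {X : ℕ → Ω → ℝ}
    (hX_law : ∀ i, HasLaw (X i) F P) (hX_indep : iIndepFun X P) (d x : ℝ) :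
    NullMeasurableSet {ω | Exceeds (walk X ω) d x} P := by
  obtain ⟨X', h1, -, -, h4⟩ := exists_measurable_version hX_law hX_indep
  refine (measurableSet_exceeds h1 d x).nullMeasurableSet.congr ?_
  filter_upwards [h4] with ω hω
  exact congrArg (fun f => Exceeds f d x) hω.symm

/-- The event `S` is caught almost surely between measurable approximations `U` and `B`, with `P B ≤
l ≤ P U`. This gives its null measurability along with its probability. -/
lemma measure_lt_maxBeforeDrawdown_brownian [IsProbabilityMeasure P] (hW : IsBrownianReal W P)
    {α D : ℝ} (hα : 0 < α) (hσ : 0 < σ) (hασ : 2 * μ / σ ^ 2 = α) (hD : 0 < D)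
    {x : ℝ} (hx : 0 ≤ x) :
    NullMeasurableSet {ω | x < maxBeforeDrawdown (driftedPath W μ σ ω) D} P ∧
    P {ω | x < maxBeforeDrawdown (driftedPath W μ σ ω) D} =
      ENNReal.ofReal (Real.exp (-(α / (Real.exp (α * D) - 1)) * x)) := by
  set δ : ℕ → ℝ≥0 := fun k => 1 / ((k : ℝ≥0) + 1) with hδdef
  have hδ : ∀ k, 0 < δ k := fun k => by simp only [hδdef]; positivity
  have hδ0 : Filter.Tendsto δ Filter.atTop (nhds 0) :=
    tendsto_one_div_add_atTop_nhds_zero_nat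
  have hq : NNReal.mk (σ ^ 2) (sq_nonneg σ) ≠ 0 :=
    fun h => (pow_pos hσ 2).ne' (congrArg NNReal.toReal h)
  set E : ℝ → ℕ → Set Ω := fun d k => {ω | Exceeds (walk (gridIncrement W μ σ (δ k)) ω) d x}
  have hEm : ∀ d k, NullMeasurableSet (E d k) P := fun d k =>
    nullMeasurableSet_exceeds_walk (hasLaw_gridIncrement hW (δ k)) (iIndepFun_gridIncrement hW _) d x
  have hElim : ∀ d, 0 < d → Filter.Tendsto (fun k => P (E d k)) Filter.atTop
      (nhds (ENNReal.ofReal (Real.exp (-(α / (Real.exp (α * d) - 1)) * x)))) := fun d hd =>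
    tendsto_measure_exceeds_gaussian hα hq hασ hδ hδ0
      (fun k i => hasLaw_gridIncrement hW (δ k) i) (fun k => iIndepFun_gridIncrement hW _) hd hx
  set S := {ω | x < maxBeforeDrawdown (driftedPath W μ σ ω) D}
  set B := {ω | ∀ᶠ k in Filter.atTop, ω ∈ E D k}
  -- Drawdown sizes tending to `D` from strictly below; the `2` keeps `u 0` positive.
  set u : ℕ → ℝ := fun j => D - D / ((j : ℝ) + 2) with hu
  have hu1 : ∀ j, u j < D := fun j => by
    have : 0 < D / ((j : ℝ) + 2) := by positivity
    simp only [hu]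
    linarith
  have hu0 : ∀ j, 0 < u j := fun j => by
    have : D / ((j : ℝ) + 2) < D := div_lt_self hD (by
      have : (0 : ℝ) ≤ j := j.cast_nonneg
      linarith)
    simp only [hu]
    linarith
  have hulim : Filter.Tendsto u Filter.atTop (nhds D) := by
    have h1 : Filter.Tendsto (fun j : ℕ => (j : ℝ) + 2) Filter.atTop Filter.atTop :=
      Filter.tendsto_atTop_add_const_right _ _ tendsto_natCast_atTop_atTop
    simpa using (h1.const_div_atTop D).const_sub D
  set U := ⋃ j, {ω | ∃ᶠ k in Filter.atTop, ω ∈ E (u j) k}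
  have hUm : NullMeasurableSet U P :=
    NullMeasurableSet.iUnion fun j => nullMeasurableSet_frequently_mem (hEm _)
  have hgood := ae_good_driftedPath (μ := μ) hσ hW
  have hUS : U ≤ᵐ[P] S := by
    filter_upwards [hgood] with ω ⟨h1, h2, h3⟩ hω
    obtain ⟨j, hj⟩ := Set.mem_iUnion.1 hω
    refine (lt_maxBeforeDrawdown_iff (bddAbove_image_Iic_of_continuous h1) (h3 D)).2 ?_
    refine exceeds_of_frequently_grid h1 hδ hδ0 (hu1 j) (h3 D) ?_
    refine Filter.Frequently.mono hj fun k hk => ?_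
    have hk' : Exceeds (walk (gridIncrement W μ σ (δ k)) ω) (u j) x := hk
    rwa [walk_gridIncrement h2] at hk'
  have hSB : S ≤ᵐ[P] B := by
    filter_upwards [hgood] with ω ⟨h1, h2, h3⟩ hω
    have hω' := (lt_maxBeforeDrawdown_iff (bddAbove_image_Iic_of_continuous h1) (h3 D)).1 hω
    filter_upwards [hω'.eventually_grid h1 hδ hδ0] with k hk
    change Exceeds (walk (gridIncrement W μ σ (δ k)) ω) D x
    rwa [walk_gridIncrement h2]
  set l := ENNReal.ofReal (Real.exp (-(α / (Real.exp (α * D) - 1)) * x))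
  have hBl : P B ≤ l := measure_eventually_mem_le (hElim D hD)
  have hUl : l ≤ P U := by
    have hne : Real.exp (α * D) - 1 ≠ 0 := by
      have : 1 < Real.exp (α * D) := Real.one_lt_exp_iff.2 (by positivity)
      linarith
    have hc : ContinuousAt (fun d => Real.exp (-(α / (Real.exp (α * d) - 1)) * x)) D := by
      have : ContinuousAt (fun d => α / (Real.exp (α * d) - 1)) D :=
        ContinuousAt.div continuousAt_const (by fun_prop) hne
      exact Real.continuous_exp.continuousAt.comp (this.neg.mul continuousAt_const)
    have hlim := ENNReal.tendsto_ofReal (hc.tendsto.comp hulim)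
    -- The exponential rate is continuous in the drawdown size, so the slack `u j < D` costs nothing
    -- in the limit.
    refine le_of_tendsto' hlim fun j => ?_
    exact (le_measure_frequently_mem (hEm _) (hElim (u j) (hu0 j))).trans
      (measure_mono (Set.subset_iUnion (fun j => {ω | ∃ᶠ k in Filter.atTop, ω ∈ E (u j) k}) j))
  have hUB : U =ᵐ[P] B := ae_eq_of_ae_subset_of_measure_ge (hUS.trans hSB) (hBl.trans hUl) hUm
    (measure_ne_top _ _)
  have hSU : U =ᵐ[P] S := hUS.antisymm (hSB.trans hUB.symm.le)
  refine ⟨hUm.congr hSU, ?_⟩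
  rw [← measure_congr hSU]
  exact le_antisymm ((measure_congr hUB).le.trans hBl) hUl

/-- The maximum of a drifted Brownian motion before a drawdown of size `D` is exponentially
distributed. -/
lemma hasLaw_maxBeforeDrawdown_brownian [IsProbabilityMeasure P] (hW : IsBrownianReal W P)
    {α D : ℝ} (hα : 0 < α) (hσ : 0 < σ) (hασ : 2 * μ / σ ^ 2 = α) (hD : 0 < D) :
    HasLaw (fun ω => maxBeforeDrawdown (driftedPath W μ σ ω) D)
      (expMeasure (α / (Real.exp (α * D) - 1))) P := by
  have hexp : 1 < Real.exp (α * D) := Real.one_lt_exp_iff.2 (by positivity)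
  have hlam : 0 < α / (Real.exp (α * D) - 1) := div_pos hα (by linarith)
  have hneg : ∀ x < 0, {ω | x < maxBeforeDrawdown (driftedPath W μ σ ω) D} =ᵐ[P] Set.univ := by
    intro x hx
    filter_upwards [ae_good_driftedPath (μ := μ) hσ hW] with ω ⟨h1, h2, h3⟩
    refine eq_true ?_
    have h4 := le_maxBeforeDrawdown_bot (d := D) (bddAbove_image_Iic_of_continuous h1)
    have h5 : driftedPath W μ σ ω ⊥ = 0 := by
      rw [bot_eq_zero']
      simp [driftedPath, h2]
    rw [h5] at h4
    exact hx.trans_le h4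
  have hm : AEMeasurable (fun ω => maxBeforeDrawdown (driftedPath W μ σ ω) D) P := by
    refine aemeasurable_of_nullMeasurableSet_Ioi fun x => ?_
    rcases lt_or_ge x 0 with hx | hx
    · exact nullMeasurableSet_univ.congr (hneg x hx).symm
    · exact (measure_lt_maxBeforeDrawdown_brownian hW hα hσ hασ hD hx).1
  refine ⟨hm, ?_⟩
  have := isProbabilityMeasure_expMeasure hlam
  have := Measure.isProbabilityMeasure_map hm
  refine Measure.ext_of_Iic _ _ fun x => ?_
  have hIoi : P.map (fun ω => maxBeforeDrawdown (driftedPath W μ σ ω) D) (Set.Ioi x) =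
      expMeasure (α / (Real.exp (α * D) - 1)) (Set.Ioi x) := by
    rw [Measure.map_apply_of_aemeasurable hm measurableSet_Ioi, expMeasure_Ioi hlam]
    split_ifs with hx
    · exact (measure_lt_maxBeforeDrawdown_brownian hW hα hσ hασ hD hx).2
    · exact (measure_congr (hneg x (not_le.1 hx))).trans measure_univ
  rw [← Set.compl_Ioi, prob_compl_eq_one_sub measurableSet_Ioi,
    prob_compl_eq_one_sub measurableSet_Ioi, hIoi]

end Brownian

end Drawdown

theorem mainTheorem2
    -- the increment distribution `F` and its adjustment coefficient `α`
    (F : Measure ℝ) [IsProbabilityMeasure F]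
    (hF_int : Integrable (fun y : ℝ => y) F)
    (hF_mean : 0 < ∫ y, y ∂F)
    (hF_neg : 0 < F (Set.Iio 0))
    (α : ℝ) (hα : 0 < α)
    (hα_int : Integrable (fun y : ℝ => Real.exp (-α * y)) F)
    (hα_eq : ∫ y, Real.exp (-α * y) ∂F = 1)
    -- the i.i.d. increments
    {Ω : Type*} [MeasurableSpace Ω] (P : Measure Ω) [IsProbabilityMeasure P]
    (X : ℕ → Ω → ℝ) (hX_law : ∀ i, HasLaw (X i) F P) (hX_indep : iIndepFun X P)
    (d : ℝ) (hd : 0 < d) :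
    -- the random walk a.s. achieves a drawdown `d`, and `M_d` is a random variable
    (∀ᵐ ω ∂P, (Drawdown.drawdownSet (Drawdown.walk X ω) d).Nonempty) ∧
    AEMeasurable (fun ω => Drawdown.maxBeforeDrawdown (Drawdown.walk X ω) d) P ∧
    -- the bound on the mean (the right-hand side is `∞` when `d_0 = ∞`)
    ∫⁻ ω, ENNReal.ofReal (Drawdown.maxBeforeDrawdown (Drawdown.walk X ω) d) ∂P ≤
      (EReal.exp ((α : EReal) * ((d : EReal) + Drawdown.dZero F α)) - 1) / ENNReal.ofReal α ∧
    -- the stochastic bound, `D` being the (finite) value of `d + d_0`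
    ∀ D : ℝ, (D : EReal) = (d : EReal) + Drawdown.dZero F α →
      (∀ x : ℝ, P {ω | x < Drawdown.maxBeforeDrawdown (Drawdown.walk X ω) d} ≤
        expMeasure (α / (Real.exp (α * D) - 1)) (Set.Ioi x)) ∧
      -- that exponential variable is `M_D` for any Brownian motion with `2 μ / σ ^ 2 = α`
      ∀ {Ω' : Type*} [MeasurableSpace Ω'] (P' : Measure Ω') [IsProbabilityMeasure P']
        (W : ℝ≥0 → Ω' → ℝ) (_ : IsBrownianReal W P') (μ σ : ℝ),
        0 < μ → 0 < σ → 2 * μ / σ ^ 2 = α →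
        HasLaw (fun ω' => Drawdown.maxBeforeDrawdown (Drawdown.driftedPath W μ σ ω') D)
          (expMeasure (α / (Real.exp (α * D) - 1))) P' ∧
        ∀ x : ℝ, P {ω | x < Drawdown.maxBeforeDrawdown (Drawdown.walk X ω) d} ≤
          P' {ω' | x < Drawdown.maxBeforeDrawdown (Drawdown.driftedPath W μ σ ω') D} := by
  refine ⟨?_, Drawdown.aemeasurable_maxBeforeDrawdown_walk hX_law hX_indep hF_neg d,
    Drawdown.lintegral_maxBeforeDrawdown_walk_le hX_law hX_indep hF_mean hF_neg hα hα_int hα_eq hd,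
    fun D hD => ?_⟩
  · obtain ⟨_, _, _, _, h⟩ := Drawdown.ae_lt_maxBeforeDrawdown_iff hX_law hX_indep hF_neg
    filter_upwards [h] with ω hω using (hω d).1
  · obtain ⟨hdD, hle⟩ := Drawdown.measure_lt_maxBeforeDrawdown_walk_le hX_law hX_indep hF_mean
      hF_neg hα hα_int hα_eq hd hD
    refine ⟨hle, fun {Ω'} _ P' _ W hW μ σ _ hσ hασ => ?_⟩
    have hlaw := Drawdown.hasLaw_maxBeforeDrawdown_brownian hW hα hσ hασ (hd.trans_le hdD)
    refine ⟨hlaw, fun x => (hle x).trans_eq ?_⟩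
    rw [← hlaw.map_eq, Measure.map_apply_of_aemeasurable hlaw.aemeasurable measurableSet_Ioi]
    rfl
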